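/- **Setting.** Let $F(x)=Ax+b$ with $A\in\mathbb R^{I\times I}$ invertible and $b\in\mathbb R^I$, let $\theta^*=-A^{-1}b$, and let $C\in\mathbb R^{I\times I}$ be a coordination matrix; the coordinated ODE is $\dot\theta=CA(\theta-\theta^*)$. A sequence $(X_k)_{k\ge 0}$ of integrable random variables (or vectors) is a martingale difference sequence if $E[X_k\mid X_l,\,l<k]=0$ almost surely for all $k$. Suppose that the measurement noise $N_k=(N_k^1,\dots,N_k^I)$, $k\ge 0$, is an $\mathbb R^I$-valued martingale difference sequence, that is, $E[N_k^j\mid N_l^i,\ l<k,\ 1\le i\le I]=0$ for all $j$ and $k$. **1. The coordinated noise.** For each $i$ the sequence $\big(\sum_j C_{i,j}N_k^j\big)_k$ is a martingale difference sequence, and so is the vector sequence $(CN_k)_k$. **2. The coordinated scheme.** Let $S=\prod_i[\ell_i,u_i]$ with $\ell_i<u_i$ for all $i$, let $\epsilon_k>0$ with $\sum_k\epsilon_k=\infty$ and $\sum_k\epsilon_k^2<\infty$, and suppose $\sup_kE\|N_k\|^2<\infty$. From an arbitrary starting point $\theta[0]$ define, with $[\,\cdot\,]^+_{S_i}$ the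 projection on $[\ell_i,u_i]$, $$\theta_i[k+1]=\Big[\theta_i[k]+\epsilon_k\sum_{j}C_{i,j}\big(F_j(\theta[k])+N_k^j\big)\Big]_{S_i}^+ .$$ Put $t_n=\sum_{k<n}\epsilon_k$. The limiting ODE is the coordinated ODE projected on $S$: a coordinate of the velocity $CA(\theta-\theta^*)$ that points out of $S$ at a boundary point is replaced by $0$ (solutions are absolutely continuous and satisfy the equation almost everywhere). Then: * (a) $\theta[k]\in S$ for all $k\ge1$. The limiting ODE has for each $x\in S$ exactly one solution $t\mapsto\Phi(t,x)\in S$, $t\ge0$, with $\Phi(0,x)=x$; it agrees with the solution of $\dot\theta=CA(\theta-\theta^*)$ from $x$ on every interval $[0,T]$ on which the latter remains in $S$. * (b) (Tracking.) Almost surely, for all $T>0$, $$\lim_{n\to\infty}\ \sup_{m\ge n,\ t_m-t_n\le T}\big\|\theta[m]-\Phi(t_m-t_n,\theta[n])\big\|=0 .$$ * (c) Almost surely, the set $L$ of limit points of $(\theta[k])_k$ is nonempty and compact, $\Phi(t,L)=L$ for all $t\ge0$, and the distance from $\theta[k]$ to $L$ tends to $0$. * (d) Almost surely, the following holds for every nonempty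 compact $U\subseteq S$ that is asymptotically stable for $\Phi$ on $S$ (invariant, Lyapunov stable, and attracting every trajectory that starts in some relatively open invariant set $B$ with $U\subseteq B\subseteq S$): if $(\theta[k])_k$ visits a compact subset of $B$ infinitely often, then the distance from $\theta[k]$ to $U$ tends to $0$. * (e) If $CA$ is a Hurwitz matrix (all its eigenvalues have negative real part) and $\theta^*$ is an interior point of $S$, then $\{\theta^*\}$ is asymptotically stable for $\Phi$ on $S$ in the sense of (d), with $B=\{x\in S:\Phi(t,x)\to\theta^*\text{ as }t\to\infty\}$. * (f) If $CA$ is a Hurwitz matrix and every solution of $\dot\theta=CA(\theta-\theta^*)$ that starts in $S$ stays in $S$ for all $t\ge 0$, then $\theta[k]\to\theta^*$ almost surely. -/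

import Mathlib

open MeasureTheory Filter Topology

noncomputable section

namespace CoordSA

/-- The `σ`-algebra generated by `X l` for `l < k`. -/
abbrev past {Ω E : Type*} [MeasurableSpace E] (X : ℕ → Ω → E) (k : ℕ) : MeasurableSpace Ω :=
  ⨆ l : Fin k, MeasurableSpace.comap (X l) inferInstance

/-- `X` is a martingale difference sequence with respect to its own history. For a vector-valued
sequence the conditioning is on the past of all the coordinates together. -/
structure IsMartingaleDifference {Ω E : Type*} [MeasurableSpace Ω] [NormedAddCommGroup E]
    [NormedSpace ℝ E] [CompleteSpace E] [MeasurableSpace E]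
    (μ : Measure Ω) (X : ℕ → Ω → E) : Prop where
  measurable : ∀ k, Measurable (X k)
  integrable : ∀ k, Integrable (X k) μ
  condExp_eq_zero : ∀ k, μ[X k | past X k] =ᵐ[μ] 0

variable {I : ℕ}

/-- The vector of updates `F(x) = A x + b`. -/
def perf (A : Matrix (Fin I) (Fin I) ℝ) (b x : Fin I → ℝ) : Fin I → ℝ :=
  A.mulVec x + b

/-- The equilibrium `θ* = - A⁻¹ b`. -/
def equilibrium (A : Matrix (Fin I) (Fin I) ℝ) (b : Fin I → ℝ) : Fin I → ℝ :=
  -(A⁻¹.mulVec b)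

/-- The right-hand side `C A (x - θ*)` of the coordinated ODE. -/
def coordField (C A : Matrix (Fin I) (Fin I) ℝ) (b x : Fin I → ℝ) : Fin I → ℝ :=
  (C * A).mulVec (x - equilibrium A b)

/-- All the (complex) eigenvalues of the real matrix `M` have negative real part. -/
def IsHurwitz (M : Matrix (Fin I) (Fin I) ℝ) : Prop :=
  ∀ z ∈ spectrum ℂ (M.map (algebraMap ℝ ℂ)), z.re < 0

/-- The projected coordinated stochastic approximation scheme: `lo i`, `hi i` are the end points of
the interval on which the `i`-th coordinate is projected, `ε` are the steps, `N k ω j` is the noise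
in the `k`-th measurement of the `j`-th indicator, `θ₀` is the initial value. -/
def coordSA {Ω : Type*} (C A : Matrix (Fin I) (Fin I) ℝ) (b lo hi : Fin I → ℝ) (ε : ℕ → ℝ)
    (N : ℕ → Ω → Fin I → ℝ) (θ₀ : Ω → Fin I → ℝ) : ℕ → Ω → Fin I → ℝ
  | 0 => θ₀
  | k + 1 => fun ω i =>
      max (lo i) (min (hi i) (coordSA C A b lo hi ε N θ₀ k ω i +
        ε k * ∑ j, C i j * (perf A b (coordSA C A b lo hi ε N θ₀ k ω) j + N k ω j)))

/-- The time `ε 0 + ... + ε (n - 1)` elapsed before the `n`-th iterate. -/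
def stepTime (ε : ℕ → ℝ) (n : ℕ) : ℝ := ∑ k ∈ Finset.range n, ε k

/-- The projection of the velocity `v` on the tangent cone at `x` of the box `[lo, hi]`: a
coordinate of the velocity that points out of the box is replaced by `0`. -/
def projField (lo hi x v : Fin I → ℝ) : Fin I → ℝ := fun i =>
  if x i ≤ lo i then max (v i) 0 else if hi i ≤ x i then min (v i) 0 else v i

/-- `y` solves on `[0, ∞)` the ODE `y' = G(y)` projected on the box `[lo, hi]`, with `y 0 = x`. As
the right-hand side is discontinuous on the boundary of the box, this is meant in the integrated
form (absolutely continuous solutions for which the equation holds almost everywhere). -/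
structure IsProjSolution (G : (Fin I → ℝ) → Fin I → ℝ) (lo hi x : Fin I → ℝ)
    (y : ℝ → Fin I → ℝ) : Prop where
  initial : y 0 = x
  continuousOn : ContinuousOn y (Set.Ici 0)
  mem_box : ∀ t, 0 ≤ t → y t ∈ Set.Icc lo hi
  eq_integral : ∀ t, 0 ≤ t → ∀ i,
    y t i = x i + ∫ s in (0 : ℝ)..t, projField lo hi (y s) (G (y s)) i

/-- `Φ t x` is the value at time `t ≥ 0` of the unique solution of the projected ODE started
at the point `x` of the box. -/
def IsProjFlow (G : (Fin I → ℝ) → Fin I → ℝ) (lo hi : Fin I → ℝ)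
    (Φ : ℝ → (Fin I → ℝ) → Fin I → ℝ) : Prop :=
  ∀ x ∈ Set.Icc lo hi, IsProjSolution G lo hi x (fun t => Φ t x) ∧
    ∀ y, IsProjSolution G lo hi x y → ∀ t, 0 ≤ t → y t = Φ t x

/-- The compact set `U` is asymptotically stable (invariant, Lyapunov stable, attracting) for the
flow `Φ` on the state space `S`, with basin of attraction containing the relatively open,
invariant set `B`. -/
structure IsAsympStable (Φ : ℝ → (Fin I → ℝ) → Fin I → ℝ) (S U B : Set (Fin I → ℝ)) : Prop where
  nonempty : U.Nonempty
  isCompact : IsCompact U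
  subset_basin : U ⊆ B
  basin_open : ∃ O, IsOpen O ∧ B = O ∩ S
  invariant : ∀ x ∈ U, ∀ t, 0 ≤ t → Φ t x ∈ U
  basin_invariant : ∀ x ∈ B, ∀ t, 0 ≤ t → Φ t x ∈ B
  lyapunov : ∀ δ₁ : ℝ, 0 < δ₁ → ∃ δ₂ : ℝ, 0 < δ₂ ∧ ∀ x ∈ S, Metric.infDist x U ≤ δ₂ →
    ∀ t, 0 ≤ t → Metric.infDist (Φ t x) U ≤ δ₁
  attracts : ∀ x ∈ B, Tendsto (fun t => Metric.infDist (Φ t x) U) atTop (𝓝 0)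

/-- The set of limit points of a sequence. -/
def limitSet (u : ℕ → Fin I → ℝ) : Set (Fin I → ℝ) := {x | MapClusterPt x atTop u}

end CoordSA

end

/-!
The projected equation `y' = G(y)` on a box is solved, coordinate by coordinate, by paths reflected
in an interval: the increments of `y i` are at least those of the driving path `∫ G (y s) i` while
`y i` is below the upper end point, and at most those of the driving path while it is above the
lower one (`CoordSA.IsReflected`). In this form everything rests on one comparison
(`CoordSA.IsReflected.sub_le_add`): since the last time at which two reflected paths were close, the
larger one has been away from the lower end point and the smaller one away from the upper end point,
so they have separated no more than their driving paths have. With Gronwall's inequality this gives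
uniqueness and Lipschitz dependence on the initial value in the sup norm
(`CoordSA.IsReflectedSolution.norm_sub_le`). Existence follows as well: the trajectories of the
Lipschitz field `κ (P(u + κ⁻¹ G(u)) - u)` on the box, with `P` the projection on the box, are
reflected up to an error that vanishes as `κ → ∞`, hence converge
(`CoordSA.exists_reflectedSolution`). The limit is Lipschitz, so it is the integral of its
derivative, which is almost everywhere the projected velocity
(`CoordSA.isProjSolution_of_isReflectedSolution`).

The comparison also holds between a reflected path and the projected recursion
(`CoordSA.exists_sub_le_of_isReflected`), and there the driving path of the recursion contains the
accumulated noise `∑ ε k * (C N k) i`. As the noise does not depend on the iterates, this is the sum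
of an `L²`-bounded martingale, so it converges almost surely
(`CoordSA.IsMartingaleDifference.ae_exists_tendsto_sum`), whatever the starting point. On that event
the tracking property `CoordSA.IsProjFlow.tracks` holds by the discrete Gronwall inequality, and all
the remaining assertions are deterministic consequences of it: invariance of the limit set
(`CoordSA.Tracks.image_limitSet`) and attraction by asymptotically stable sets
(`CoordSA.IsAsympStable.tendsto_infDist`).

For a Hurwitz matrix `A` the spectral radius of `1 + h A` is less than `1` for small `h > 0`, so that
the powers of this matrix decay geometrically, and with them the solution operators
`exp (t A) = exp (-t / h) exp ((t / h) (1 + h A))`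
(`CoordSA.IsHurwitz.exists_exponential_decay`). Where the linear equation remains in the box it has
the same trajectories as the projected one, which makes the equilibrium asymptotically stable.
-/

namespace CoordSA

/-! ### Martingale difference sequences -/

section

variable {Ω : Type*} [MeasurableSpace Ω] {μ : Measure Ω}

lemma past_le {E : Type*} [MeasurableSpace E] {X : ℕ → Ω → E} (hX : ∀ k, Measurable (X k))
    (k : ℕ) : past X k ≤ ‹MeasurableSpace Ω› :=
  iSup_le fun l => (hX l).comap_le

lemma past_mono {Ω E : Type*} [MeasurableSpace E] (X : ℕ → Ω → E) : Monotone (past X) :=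
  fun _ _ h => iSup_le fun l => le_iSup_of_le (Fin.castLE h l) le_rfl

lemma measurable_past {Ω E : Type*} [MeasurableSpace E] (X : ℕ → Ω → E) {l k : ℕ} (h : l < k) :
    Measurable[past X k] (X l) :=
  (comap_measurable (X l)).mono
    (le_iSup (fun l : Fin k => MeasurableSpace.comap (X l) inferInstance) ⟨l, h⟩) le_rfl

lemma past_comp_le {Ω E F : Type*} [MeasurableSpace E] [MeasurableSpace F] (X : ℕ → Ω → E)
    {g : E → F} (hg : Measurable g) (k : ℕ) : past (fun k ω => g (X k ω)) k ≤ past X k :=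
  iSup_le fun l => (hg.comp (measurable_past X l.2)).comap_le

/-- The image has a smaller past, so the conditional expectation vanishes by the tower property. -/
theorem IsMartingaleDifference.clm_comp {E F : Type*}
    [NormedAddCommGroup E] [NormedSpace ℝ E] [CompleteSpace E] [MeasurableSpace E] [BorelSpace E]
    [NormedAddCommGroup F] [NormedSpace ℝ F] [CompleteSpace F] [MeasurableSpace F] [BorelSpace F]
    [IsFiniteMeasure μ] {X : ℕ → Ω → E}
    (hX : IsMartingaleDifference μ X) (L : E →L[ℝ] F) :
    IsMartingaleDifference μ (fun k ω => L (X k ω)) where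
  measurable k := L.continuous.measurable.comp (hX.measurable k)
  integrable k := L.integrable_comp (hX.integrable k)
  condExp_eq_zero k := by
    have h1 : μ[fun ω => L (X k ω) | past X k] =ᵐ[μ] 0 := by
      have h := L.comp_condExp_comm (m := past X k) (hX.integrable k)
      refine h.symm.trans ?_
      filter_upwards [hX.condExp_eq_zero k] with ω hω
      simp [hω]
    have h2 := condExp_condExp_of_le (μ := μ) (f := fun ω => L (X k ω))
      (past_comp_le X L.continuous.measurable k) (past_le hX.measurable k)
    refine h2.symm.trans ((condExp_congr_ae h1).trans ?_)
    rw [condExp_zero]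

/-- The partial sums of `∑ ε k * X k` for square-summable weights `ε` and an `L²`-bounded scalar
martingale difference sequence `X` form an `L²`-bounded martingale, hence converge. -/
theorem IsMartingaleDifference.ae_exists_tendsto_sum [IsProbabilityMeasure μ] {X : ℕ → Ω → ℝ}
    (hX : IsMartingaleDifference μ X) {ε : ℕ → ℝ} (hε : Summable fun k => ε k ^ 2) {K : NNReal}
    (hK : ∀ k, eLpNorm (X k) 2 μ ≤ K) :
    ∀ᵐ ω ∂μ, ∃ c, Tendsto (fun n => ∑ k ∈ Finset.range n, ε k * X k ω) atTop (𝓝 c) := by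
  set S : ℕ → Ω → ℝ := fun n ω => ∑ k ∈ Finset.range n, ε k * X k ω with hS
  have hX2 : ∀ k, MemLp (X k) 2 μ := fun k =>
    ⟨(hX.measurable k).aestronglyMeasurable, (hK k).trans_lt ENNReal.coe_lt_top⟩
  have hS2 : ∀ n, MemLp (S n) 2 μ := fun n =>
    memLp_finsetSum _ fun k _ => (hX2 k).const_mul (ε k)
  let ℱ : Filtration ℕ ‹MeasurableSpace Ω› := ⟨past X, past_mono X, past_le hX.measurable⟩
  have hSm : ∀ n, StronglyMeasurable[past X n] (S n) := fun n => by
    refine Measurable.stronglyMeasurable (Finset.measurable_fun_sum _ fun k hk => ?_)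
    exact (measurable_past X (Finset.mem_range.1 hk)).const_mul _
  have hSsucc : ∀ n, S (n + 1) = S n + fun ω => ε n * X n ω := fun n => by
    ext ω; simp [hS, Finset.sum_range_succ]
  have hmart : Martingale S ℱ μ := by
    refine martingale_of_condExp_sub_eq_zero_nat hSm
      (fun n => (hS2 n).integrable one_le_two) fun n => ?_
    have : S (n + 1) - S n = ε n • X n := by rw [hSsucc]; ext; simp
    rw [this]
    refine (condExp_smul _ _ _).trans ?_
    filter_upwards [hX.condExp_eq_zero n] with ω hω
    simp only [Pi.smul_apply, Pi.zero_apply]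
    rw [show (μ[X n | ℱ n]) ω = 0 from hω]
    simp
  have hXsq : ∀ k, ∫ ω, X k ω ^ 2 ∂μ ≤ (K : ℝ) ^ 2 := fun k => by
    have h := hK k
    rw [(hX2 k).eLpNorm_eq_integral_rpow_norm (by simp) (by simp)] at h
    simp only [ENNReal.toReal_ofNat, Real.rpow_two, Real.norm_eq_abs, sq_abs] at h
    rw [ENNReal.ofReal_le_iff_le_toReal ENNReal.coe_ne_top, ENNReal.coe_toReal] at h
    have h0 : 0 ≤ ∫ ω, X k ω ^ 2 ∂μ := integral_nonneg fun ω => sq_nonneg _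
    calc _ = ((∫ ω, X k ω ^ 2 ∂μ) ^ ((2 : ℝ)⁻¹)) ^ 2 := by
            rw [← Real.rpow_natCast, ← Real.rpow_mul h0]; norm_num
      _ ≤ _ := by gcongr
  -- orthogonality of the increment to the past
  have horth : ∀ n, ∫ ω, S n ω * X n ω ∂μ = 0 := fun n => by
    have hint : Integrable (S n * X n) μ := (hS2 n).integrable_mul (hX2 n)
    have h := condExp_mul_of_stronglyMeasurable_left (μ := μ) (hSm n) hint (hX.integrable n)
    have h' : μ[S n * X n | past X n] =ᵐ[μ] 0 := by
      filter_upwards [h, hX.condExp_eq_zero n] with ω h1 h2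
      simp [h1, h2]
    have := integral_condExp (μ := μ) (f := S n * X n) (past_le hX.measurable n)
    rw [integral_congr_ae h'] at this
    simpa using this.symm
  have hSsq : ∀ n, ∫ ω, S n ω ^ 2 ∂μ ≤ (K : ℝ) ^ 2 * ∑ k ∈ Finset.range n, ε k ^ 2 := by
    intro n
    induction n with
    | zero => simp [hS]
    | succ n ih =>
      have h1 : ∀ ω, S (n + 1) ω ^ 2 =
          S n ω ^ 2 + (2 * ε n * (S n ω * X n ω) + ε n ^ 2 * X n ω ^ 2) := fun ω => by
        rw [hSsucc]; simp only [Pi.add_apply]; ring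
      have i1 : Integrable (fun ω => S n ω * X n ω) μ := (hS2 n).integrable_mul (hX2 n)
      have i2 := (hX2 n).integrable_sq
      simp_rw [h1]
      have i3 : Integrable
          (fun ω => 2 * ε n * (S n ω * X n ω) + ε n ^ 2 * X n ω ^ 2) μ :=
        (i1.const_mul _).add (i2.const_mul _)
      rw [integral_add (hS2 n).integrable_sq i3,
        integral_add (i1.const_mul _) (i2.const_mul _), integral_const_mul, integral_const_mul,
        horth, Finset.sum_range_succ]
      nlinarith [mul_le_mul_of_nonneg_left (hXsq n) (sq_nonneg (ε n))]
  set R : ℝ := 1 + (K : ℝ) ^ 2 * ∑' k, ε k ^ 2 with hR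
  have hR0 : 0 ≤ R := by
    have : 0 ≤ ∑' k, ε k ^ 2 := tsum_nonneg fun k => sq_nonneg _
    positivity
  refine hmart.submartingale.exists_ae_tendsto_of_bdd (R := R.toNNReal) fun n => ?_
  rw [eLpNorm_one_eq_lintegral_enorm,
    ← ofReal_integral_norm_eq_lintegral_enorm ((hS2 n).integrable one_le_two)]
  change ENNReal.ofReal _ ≤ ENNReal.ofReal R
  refine ENNReal.ofReal_le_ofReal ?_
  calc ∫ ω, ‖S n ω‖ ∂μ ≤ ∫ ω, (1 + S n ω ^ 2) ∂μ := by
        refine integral_mono ((hS2 n).integrable one_le_two).norm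
          ((integrable_const _).add (hS2 n).integrable_sq) fun ω => ?_
        simp only [Real.norm_eq_abs]
        rw [← sq_abs]
        nlinarith [sq_nonneg (|S n ω| - 1), abs_nonneg (S n ω)]
    _ = 1 + ∫ ω, S n ω ^ 2 ∂μ := by
        rw [integral_add (integrable_const _) (hS2 n).integrable_sq]; simp
    _ ≤ R := by
        have := hε.sum_le_tsum (Finset.range n) fun k _ => sq_nonneg (ε k)
        have := mul_le_mul_of_nonneg_left this (sq_nonneg (K : ℝ))
        linarith [hSsq n]

end

/-! ### Paths reflected in an interval and their comparison -/

section

/-- On `[0, T]` the continuous path `y` in `[lo, hi]` follows the driving path `ψ`, except that near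
the end points it may be pushed into the interval: its increments are at least those of `ψ` while
it stays `e` away from `hi`, and at most those of `ψ` while it stays `e` away from `lo`. For `e = 0`
this is the solution of the Skorokhod problem for `ψ`. -/
structure IsReflected (lo hi e T : ℝ) (ψ y : ℝ → ℝ) : Prop where
  continuousOn : ContinuousOn y (Set.Icc 0 T)
  mem_Icc : ∀ t ∈ Set.Icc 0 T, y t ∈ Set.Icc lo hi
  le_sub : ∀ s t, 0 ≤ s → s ≤ t → t ≤ T → (∀ r ∈ Set.Icc s t, y r < hi - e) →
    ψ t - ψ s ≤ y t - y s
  sub_le : ∀ s t, 0 ≤ s → s ≤ t → t ≤ T → (∀ r ∈ Set.Icc s t, lo + e < y r) →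
    y t - y s ≤ ψ t - ψ s

/-- Two reflected paths separate no more than their driving paths do: since the last time at which
`y - y'` was at most `E`, the path `y` was away from `lo` and `y'` away from `hi`, so that the
reflection could only bring them together. -/
theorem IsReflected.sub_le_add {lo hi e e' T E D t : ℝ} {ψ ψ' y y' : ℝ → ℝ}
    (h : IsReflected lo hi e T ψ y) (h' : IsReflected lo hi e' T ψ' y')
    (he : e ≤ E) (he' : e' ≤ E) (h0 : y 0 - y' 0 ≤ E) (ht : t ∈ Set.Icc 0 T)
    (hD : ∀ s ∈ Set.Icc 0 t, (ψ t - ψ s) - (ψ' t - ψ' s) ≤ D) : y t - y' t ≤ E + D := by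
  have hD0 : 0 ≤ D := by simpa using hD t ⟨ht.1, le_rfl⟩
  by_contra! hlt
  set g : ℝ → ℝ := fun s => y s - y' s with hg
  have hsub : Set.Icc 0 t ⊆ Set.Icc 0 T := Set.Icc_subset_Icc_right ht.2
  have hgc : ContinuousOn g (Set.Icc 0 t) :=
    (h.continuousOn.mono hsub).sub (h'.continuousOn.mono hsub)
  have hA : IsCompact {s ∈ Set.Icc 0 t | g s ≤ E} :=
    isCompact_Icc.of_isClosed_subset (hgc.preimage_isClosed_of_isClosed isClosed_Icc isClosed_Iic)
      fun s hs => hs.1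
  obtain ⟨a, ⟨ha, haE⟩, hmax⟩ := hA.exists_isGreatest ⟨0, ⟨le_rfl, ht.1⟩, h0⟩
  have hgt : ∀ s, a < s → s ≤ t → E < g s := fun s h1 h2 => by
    by_contra! h3
    exact absurd (hmax ⟨⟨ha.1.trans h1.le, h2⟩, h3⟩) (not_le.2 h1)
  have hat : a < t := lt_of_le_of_ne ha.2 fun h => by
    subst h; have : g a = y a - y' a := rfl; linarith
  have hstep : ∀ s, a < s → s ≤ t → g t - D ≤ g s := fun s h1 h2 => by
    have hs0 : 0 ≤ s := ha.1.trans h1.le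
    have hbox : ∀ r ∈ Set.Icc s t, lo + e < y r ∧ y' r < hi - e' := fun r hr => by
      have hrT : r ∈ Set.Icc 0 T := ⟨hs0.trans hr.1, hr.2.trans ht.2⟩
      have h3 : E < y r - y' r := hgt r (h1.trans_le hr.1) hr.2
      have h4 := (h'.mem_Icc r hrT).1
      have h5 := (h.mem_Icc r hrT).2
      constructor <;> linarith
    have h3 := h.sub_le s t hs0 h2 ht.2 fun r hr => (hbox r hr).1
    have h4 := h'.le_sub s t hs0 h2 ht.2 fun r hr => (hbox r hr).2
    have h5 := hD s ⟨hs0, h2⟩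
    simp only [hg]
    linarith
  have hlim : Tendsto g (𝓝[Set.Ioc a t] a) (𝓝 (g a)) :=
    (hgc a ha).mono_left (nhdsWithin_mono _ fun s hs => ⟨ha.1.trans hs.1.le, hs.2⟩)
  have hne : (𝓝[Set.Ioc a t] a).NeBot := by
    rw [nhdsWithin_Ioc_eq_nhdsGT hat]; infer_instance
  have hge : g t - D ≤ g a := ge_of_tendsto hlim
    (eventually_nhdsWithin_of_forall fun s hs => hstep s hs.1 hs.2)
  have : g t = y t - y' t := rfl
  linarith

/-- A path which is the integral of a velocity `w` is reflected with respect to the integral of `v`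
as soon as `w` and `v` compare in the right way off the end points. -/
lemma IsReflected.of_eq_integral {lo hi e T : ℝ} {v w y : ℝ → ℝ}
    (hc : ContinuousOn y (Set.Icc 0 T)) (hbox : ∀ t ∈ Set.Icc 0 T, y t ∈ Set.Icc lo hi)
    (hv : IntervalIntegrable v volume 0 T) (hw : IntervalIntegrable w volume 0 T)
    (hy : ∀ t ∈ Set.Icc 0 T, y t = y 0 + ∫ s in (0 : ℝ)..t, w s)
    (hup : ∀ r ∈ Set.Icc 0 T, y r < hi - e → v r ≤ w r)
    (hdown : ∀ r ∈ Set.Icc 0 T, lo + e < y r → w r ≤ v r) :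
    IsReflected lo hi e T (fun t => ∫ s in (0 : ℝ)..t, v s) y := by
  have hmono {f : ℝ → ℝ} (hf : IntervalIntegrable f volume 0 T) {a b : ℝ} (h1 : 0 ≤ a)
      (h2 : a ≤ b) (h3 : b ≤ T) : IntervalIntegrable f volume a b :=
    hf.mono_set (by
      rw [Set.uIcc_of_le h2, Set.uIcc_of_le (h1.trans (h2.trans h3))]
      exact Set.Icc_subset_Icc h1 h3)
  have hdiff {f : ℝ → ℝ} (hf : IntervalIntegrable f volume 0 T) {a b : ℝ} (h1 : 0 ≤ a)
      (h2 : a ≤ b) (h3 : b ≤ T) :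
      (∫ s in (0 : ℝ)..b, f s) - ∫ s in (0 : ℝ)..a, f s = ∫ s in a..b, f s :=
    intervalIntegral.integral_interval_sub_left
      (hmono hf le_rfl (h1.trans h2) h3) (hmono hf le_rfl h1 (h2.trans h3))
  refine ⟨hc, hbox, fun s t h0 hst hT hr => ?_, fun s t h0 hst hT hr => ?_⟩
  all_goals
    rw [hdiff hv h0 hst hT, hy t ⟨h0.trans hst, hT⟩, hy s ⟨h0, hst.trans hT⟩,
      add_sub_add_left_eq_sub, hdiff hw h0 hst hT]
  · exact intervalIntegral.integral_mono_on hst (hmono hv h0 hst hT) (hmono hw h0 hst hT)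
      fun r hr' => hup r ⟨h0.trans hr'.1, hr'.2.trans hT⟩ (hr r hr')
  · exact intervalIntegral.integral_mono_on hst (hmono hw h0 hst hT) (hmono hv h0 hst hT)
      fun r hr' => hdown r ⟨h0.trans hr'.1, hr'.2.trans hT⟩ (hr r hr')

/-- Gronwall's inequality in integral form. -/
lemma le_mul_exp_of_le_add_integral {f : ℝ → ℝ} {c L T : ℝ} (hL : 0 ≤ L)
    (hf : ContinuousOn f (Set.Icc 0 T))
    (h : ∀ t ∈ Set.Icc 0 T, f t ≤ c + L * ∫ s in (0 : ℝ)..t, f s) :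
    ∀ t ∈ Set.Icc 0 T, f t ≤ c * Real.exp (L * t) := by
  intro t ht
  have hT : 0 ≤ T := ht.1.trans ht.2
  set g : ℝ → ℝ := Set.IccExtend hT (fun x => f x) with hg
  have hgc : Continuous g := (continuousOn_iff_continuous_domRestrict.1 hf).Icc_extend'
  have hgf : ∀ s ∈ Set.Icc 0 T, g s = f s := fun s hs => Set.IccExtend_of_mem hT _ hs
  have hint : ∀ t ∈ Set.Icc 0 T, ∫ s in (0 : ℝ)..t, f s = ∫ s in (0 : ℝ)..t, g s :=
    fun t ht => intervalIntegral.integral_congr fun s hs => by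
      rw [Set.uIcc_of_le ht.1] at hs
      exact (hgf s ⟨hs.1, hs.2.trans ht.2⟩).symm
  set F : ℝ → ℝ := fun t => c + L * ∫ s in (0 : ℝ)..t, g s with hF
  have hd : ∀ t, HasDerivAt F (L * g t) t := fun t =>
    ((intervalIntegral.integral_hasDerivAt_right (hgc.intervalIntegrable _ _)
      (hgc.stronglyMeasurableAtFilter _ _) hgc.continuousAt).const_mul L).const_add c
  have hle : ∀ t ∈ Set.Icc 0 T, f t ≤ F t := fun t ht => by
    have := h t ht
    rwa [hint t ht] at this
  have hb := le_gronwallBound_of_liminf_deriv_right_le (f := F) (f' := fun t => L * g t) (δ := c)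
    (K := L) (ε := 0) (a := 0) (b := T) (fun t _ => (hd t).continuousAt.continuousWithinAt)
    (fun t _ r hr => (hd t).hasDerivWithinAt.liminf_right_slope_le hr)
    (by simp [hF]) (fun t ht => by
      have ht' : t ∈ Set.Icc 0 T := ⟨ht.1, ht.2.le⟩
      rw [add_zero, hgf t ht']
      exact mul_le_mul_of_nonneg_left (hle t ht') hL) t ht
  rw [gronwallBound_ε0, sub_zero] at hb
  exact (hle t ht).trans hb

variable {I : ℕ} {G : (Fin I → ℝ) → Fin I → ℝ} {lo hi : Fin I → ℝ}

/-- The coordinates of `y` are reflected, up to the tolerance `e`, in the sides of the box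
`[lo, hi]`, with the integral of `G (y s)` as driving path. -/
def IsReflectedSolution (G : (Fin I → ℝ) → Fin I → ℝ) (lo hi : Fin I → ℝ) (e T : ℝ)
    (y : ℝ → Fin I → ℝ) : Prop :=
  ∀ i, IsReflected (lo i) (hi i) e T (fun t => ∫ s in (0 : ℝ)..t, G (y s) i) (fun t => y t i)

lemma IsReflectedSolution.continuousOn {e T : ℝ} {y : ℝ → Fin I → ℝ}
    (hy : IsReflectedSolution G lo hi e T y) : ContinuousOn y (Set.Icc 0 T) :=
  continuousOn_pi.2 fun i => (hy i).continuousOn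

lemma IsReflectedSolution.mem_box {e T : ℝ} {y : ℝ → Fin I → ℝ}
    (hy : IsReflectedSolution G lo hi e T y) : ∀ t ∈ Set.Icc 0 T, y t ∈ Set.Icc lo hi :=
  fun t ht => ⟨fun i => ((hy i).mem_Icc t ht).1, fun i => ((hy i).mem_Icc t ht).2⟩

lemma IsReflectedSolution.mono {e T T' : ℝ} {y : ℝ → Fin I → ℝ}
    (hy : IsReflectedSolution G lo hi e T y) (hT : T' ≤ T) : IsReflectedSolution G lo hi e T' y :=
  fun i => ⟨(hy i).continuousOn.mono (Set.Icc_subset_Icc_right hT),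
    fun t ht => (hy i).mem_Icc t ⟨ht.1, ht.2.trans hT⟩,
    fun s t h1 h2 h3 => (hy i).le_sub s t h1 h2 (h3.trans hT),
    fun s t h1 h2 h3 => (hy i).sub_le s t h1 h2 (h3.trans hT)⟩

/-- Stability of reflected solutions, from the comparison of reflected paths in each coordinate and
Gronwall's inequality. -/
theorem IsReflectedSolution.norm_sub_le {e e' E T : ℝ} {y z : ℝ → Fin I → ℝ} {L : NNReal}
    (hy : IsReflectedSolution G lo hi e T y) (hz : IsReflectedSolution G lo hi e' T z)
    (hG : LipschitzWith L G) (he : e ≤ E) (he' : e' ≤ E) (h0 : ‖y 0 - z 0‖ ≤ E) :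
    ∀ t ∈ Set.Icc 0 T, ‖y t - z t‖ ≤ E * Real.exp (L * t) := by
  have hE : 0 ≤ E := (norm_nonneg _).trans h0
  have hf : ContinuousOn (fun t => ‖y t - z t‖) (Set.Icc 0 T) :=
    (hy.continuousOn.sub hz.continuousOn).norm
  refine le_mul_exp_of_le_add_integral L.2 hf fun t ht => ?_
  have hII : ∀ {a b : ℝ}, 0 ≤ a → a ≤ b → b ≤ T → Set.uIcc a b ⊆ Set.Icc 0 T :=
    fun h1 h2 h3 => by rw [Set.uIcc_of_le h2]; exact Set.Icc_subset_Icc h1 h3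
  have key : ∀ {y z : ℝ → Fin I → ℝ}, ContinuousOn y (Set.Icc 0 T) →
      ContinuousOn z (Set.Icc 0 T) → ∀ i, ∀ s ∈ Set.Icc 0 t,
      ((∫ r in (0 : ℝ)..t, G (y r) i) - ∫ r in (0 : ℝ)..s, G (y r) i) -
        ((∫ r in (0 : ℝ)..t, G (z r) i) - ∫ r in (0 : ℝ)..s, G (z r) i) ≤
          L * ∫ r in (0 : ℝ)..t, ‖y r - z r‖ := by
    intro y z hyc hzc i s hs
    have hGi : Continuous fun u => G u i := (continuous_apply i).comp hG.continuous
    have iy : ∀ {a b : ℝ}, 0 ≤ a → a ≤ b → b ≤ T →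
        IntervalIntegrable (fun r => G (y r) i) volume a b := fun h1 h2 h3 =>
      (hGi.comp_continuousOn (hyc.mono (hII h1 h2 h3))).intervalIntegrable
    have iz : ∀ {a b : ℝ}, 0 ≤ a → a ≤ b → b ≤ T →
        IntervalIntegrable (fun r => G (z r) i) volume a b := fun h1 h2 h3 =>
      (hGi.comp_continuousOn (hzc.mono (hII h1 h2 h3))).intervalIntegrable
    have id : ∀ {a b : ℝ}, 0 ≤ a → a ≤ b → b ≤ T →
        IntervalIntegrable (fun r => ‖y r - z r‖) volume a b := fun h1 h2 h3 =>
      (((hyc.sub hzc).norm).mono (hII h1 h2 h3)).intervalIntegrable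
    rw [intervalIntegral.integral_interval_sub_left (iy le_rfl ht.1 ht.2)
        (iy le_rfl hs.1 (hs.2.trans ht.2)),
      intervalIntegral.integral_interval_sub_left (iz le_rfl ht.1 ht.2)
        (iz le_rfl hs.1 (hs.2.trans ht.2)),
      ← intervalIntegral.integral_sub (iy hs.1 hs.2 ht.2) (iz hs.1 hs.2 ht.2)]
    calc _ ≤ ∫ r in s..t, L * ‖y r - z r‖ := by
          refine intervalIntegral.integral_mono_on hs.2
            ((iy hs.1 hs.2 ht.2).sub (iz hs.1 hs.2 ht.2)) ((id hs.1 hs.2 ht.2).const_mul _)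
            fun r _ => ?_
          calc G (y r) i - G (z r) i ≤ ‖(G (y r) - G (z r)) i‖ := le_abs_self _
            _ ≤ ‖G (y r) - G (z r)‖ := norm_le_pi_norm _ i
            _ ≤ L * ‖y r - z r‖ := hG.norm_sub_le _ _
      _ = L * ∫ r in s..t, ‖y r - z r‖ := intervalIntegral.integral_const_mul _ _
      _ ≤ _ := by
          refine mul_le_mul_of_nonneg_left ?_ L.2
          rw [← intervalIntegral.integral_add_adjacent_intervals
            (id le_rfl hs.1 (hs.2.trans ht.2)) (id hs.1 hs.2 ht.2)]
          have : 0 ≤ ∫ r in (0 : ℝ)..s, ‖y r - z r‖ :=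
            intervalIntegral.integral_nonneg hs.1 fun r _ => norm_nonneg _
          linarith
  have hI0 : 0 ≤ ∫ s in (0 : ℝ)..t, ‖y s - z s‖ :=
    intervalIntegral.integral_nonneg ht.1 fun r _ => norm_nonneg _
  refine (pi_norm_le_iff_of_nonneg (add_nonneg hE (mul_nonneg L.2 hI0))).2 fun i => ?_
  have h0i : |y 0 i - z 0 i| ≤ E := (norm_le_pi_norm (y 0 - z 0) i).trans h0
  rw [Pi.sub_apply, Real.norm_eq_abs, abs_le']
  constructor
  · exact (hy i).sub_le_add (hz i) he he' (le_trans (le_abs_self _) h0i) ht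
      fun s hs => key hy.continuousOn hz.continuousOn i s hs
  · rw [neg_sub]
    refine (hz i).sub_le_add (hy i) he' he (le_trans ?_ h0i) ht fun s hs => ?_
    · rw [abs_sub_comm]; exact le_abs_self _
    · simp_rw [norm_sub_rev (y _)]
      exact key hz.continuousOn hy.continuousOn i s hs

end

/-! ### Existence of reflected solutions -/

section

variable {I : ℕ} {G : (Fin I → ℝ) → Fin I → ℝ} {lo hi : Fin I → ℝ}

/-- The projection on the box `[lo, hi]`. -/
def boxProj (lo hi x : Fin I → ℝ) : Fin I → ℝ := fun i => max (lo i) (min (hi i) (x i))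

lemma boxProj_mem (h : ∀ i, lo i ≤ hi i) (x : Fin I → ℝ) : boxProj lo hi x ∈ Set.Icc lo hi :=
  ⟨fun _ => le_max_left _ _, fun i => max_le (h i) (min_le_left _ _)⟩

lemma boxProj_of_mem {x : Fin I → ℝ} (hx : x ∈ Set.Icc lo hi) : boxProj lo hi x = x :=
  funext fun i => by
    have h1 : lo i ≤ x i := hx.1 i
    have h2 : x i ≤ hi i := hx.2 i
    simp [boxProj, h1, h2]

lemma lipschitzWith_boxProj (lo hi : Fin I → ℝ) : LipschitzWith 1 (boxProj lo hi) :=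
  LipschitzWith.of_dist_le_mul fun x y => by
    rw [NNReal.coe_one, one_mul]
    refine (dist_pi_le_iff dist_nonneg).2 fun i => le_trans ?_ (dist_le_pi_dist x y i)
    rw [Real.dist_eq, Real.dist_eq, boxProj, boxProj, max_comm, max_comm (lo i)]
    refine (abs_max_sub_max_le_abs _ _ _).trans ?_
    rw [min_comm, min_comm (hi i)]
    exact abs_min_sub_min_le_max _ _ _ _ |>.trans (by simp)

/-- The velocity with which the point `u`, projected on the box, moves towards the projection of
`u + κ⁻¹ G(u)`. -/
noncomputable def relaxedField (G : (Fin I → ℝ) → Fin I → ℝ) (lo hi : Fin I → ℝ) (κ : ℝ)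
    (u : Fin I → ℝ) : Fin I → ℝ :=
  κ • (boxProj lo hi (boxProj lo hi u + κ⁻¹ • G (boxProj lo hi u)) - boxProj lo hi u)

lemma exists_lipschitzWith_relaxedField {L : NNReal} (hG : LipschitzWith L G) (κ : ℝ) :
    ∃ K, LipschitzWith K (relaxedField G lo hi κ) := by
  have hc := lipschitzWith_boxProj lo hi
  exact ⟨_, (lipschitzWith_smul κ).comp ((hc.comp (hc.add
    ((lipschitzWith_smul κ⁻¹).comp (hG.comp hc)))).sub hc)⟩

lemma norm_relaxedField_le (h : ∀ i, lo i ≤ hi i) {M : ℝ} (hM : ∀ u ∈ Set.Icc lo hi, ‖G u‖ ≤ M)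
    {κ : ℝ} (hκ : 0 < κ) (u : Fin I → ℝ) : ‖relaxedField G lo hi κ u‖ ≤ M := by
  have hm := boxProj_mem h u
  rw [relaxedField, norm_smul, Real.norm_of_nonneg hκ.le]
  have h1 := (lipschitzWith_boxProj lo hi).norm_sub_le
    (boxProj lo hi u + κ⁻¹ • G (boxProj lo hi u)) (boxProj lo hi u)
  rw [boxProj_of_mem hm, NNReal.coe_one, one_mul, add_sub_cancel_left, norm_smul,
    Real.norm_of_nonneg (inv_pos.2 hκ).le] at h1
  calc _ ≤ κ * (κ⁻¹ * ‖G (boxProj lo hi u)‖) := by gcongr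
    _ = ‖G (boxProj lo hi u)‖ := by field_simp
    _ ≤ M := hM _ hm

/-- The trajectories of the relaxed field do not leave the box, and off the `e`-neighbourhood of
an end point, where `κ⁻¹ M ≤ e`, the projection on that end point is not active. -/
lemma exists_approx_reflectedSolution (h : ∀ i, lo i ≤ hi i) {L M : NNReal}
    (hG : LipschitzWith L G) (hM : ∀ u ∈ Set.Icc lo hi, ‖G u‖ ≤ M) {e T : ℝ} (he : 0 < e)
    (hT : 0 ≤ T) {x : Fin I → ℝ} (hx : x ∈ Set.Icc lo hi) :
    ∃ y : ℝ → Fin I → ℝ, y 0 = x ∧ IsReflectedSolution G lo hi e T y ∧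
      LipschitzOnWith M y (Set.Icc 0 T) := by
  obtain ⟨κ, hκ, hκe⟩ : ∃ κ : ℝ, 0 < κ ∧ κ⁻¹ * M ≤ e :=
    ⟨(M + 1) / e, by positivity, by
      rw [inv_div, div_mul_eq_mul_div, div_le_iff₀ (by positivity)]
      nlinarith [M.2]⟩
  set f := relaxedField G lo hi κ with hf
  obtain ⟨K, hK⟩ := exists_lipschitzWith_relaxedField (lo := lo) (hi := hi) hG κ
  have hfM : ∀ u, ‖f u‖ ≤ M := norm_relaxedField_le h hM hκ
  have hPL : IsPicardLindelof (fun _ => f) (tmin := 0) (tmax := T) ⟨0, le_rfl, hT⟩ x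
      (M * T.toNNReal) 0 M K := .of_time_independent (fun u _ => hfM u) hK.lipschitzOnWith
        (by simp [hT])
  obtain ⟨y, hy0, hy⟩ := hPL.exists_eq_forall_mem_Icc_hasDerivWithinAt
    (Metric.mem_closedBall_self (by simp))
  have hyc : ContinuousOn y (Set.Icc 0 T) := fun t ht => (hy t ht).continuousWithinAt
  have hyi : ∀ i, ContinuousOn (fun t => y t i) (Set.Icc 0 T) := continuousOn_pi.1 hyc
  have hd : ∀ i, ∀ t ∈ Set.Icc 0 T, HasDerivWithinAt (fun t => y t i) (f (y t) i) (Set.Icc 0 T) t :=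
    fun i t ht => hasDerivWithinAt_pi.1 (hy t ht) i
  have hdr : ∀ i, ∀ t ∈ Set.Ico 0 T, HasDerivWithinAt (fun t => y t i) (f (y t) i) (Set.Ici t) t :=
    fun i t ht => ((hd i t ⟨ht.1, ht.2.le⟩).mono
      (Set.Icc_subset_Icc_left ht.1)).mono_of_mem_nhdsWithin (Icc_mem_nhdsGE ht.2)
  have hfi : ∀ u i, f u i = κ * (max (lo i) (min (hi i)
      (boxProj lo hi u i + κ⁻¹ * G (boxProj lo hi u) i)) - boxProj lo hi u i) := fun u i => rfl
  have hGi : ∀ u ∈ Set.Icc lo hi, ∀ i, |κ⁻¹ * G u i| ≤ e := fun u hu i => by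
    rw [abs_mul, abs_of_pos (inv_pos.2 hκ)]
    refine le_trans ?_ hκe
    gcongr
    exact (norm_le_pi_norm (G u) i).trans (hM u hu)
  -- At and beyond an end point the relaxed field does not point outwards, so the trajectory cannot
  -- cross a barrier that moves outwards with the positive speed `δ / (1 + T)`.
  have hupper : ∀ i, ∀ t ∈ Set.Icc 0 T, y t i ≤ hi i := by
    intro i t ht
    refine le_of_forall_pos_le_add fun δ hδ => ?_
    have hδ' : 0 < δ / (1 + T) := by positivity
    have := image_le_of_deriv_right_lt_deriv_boundary (a := 0) (b := T) (hyi i) (hdr i)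
      (B := fun t => hi i + δ / (1 + T) * (1 + t)) (B' := fun _ => δ / (1 + T))
      (by rw [hy0]; have := hx.2 i; linarith)
      (fun t => by
        simpa using
          (((hasDerivAt_id t).const_add (1 : ℝ)).const_mul (δ / (1 + T))).const_add (hi i))
      (fun t ht h1 => by
        have h2 : hi i ≤ y t i := by
          rw [h1]; have := mul_nonneg hδ'.le (by linarith [ht.1] : 0 ≤ 1 + t); linarith
        have h3 : boxProj lo hi (y t) i = hi i := by simp [boxProj, h2, h i]
        rw [hfi, h3]
        have : max (lo i) (min (hi i) (hi i + κ⁻¹ * G (boxProj lo hi (y t)) i)) ≤ hi i :=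
          max_le (h i) (min_le_left _ _)
        nlinarith) ht
    refine this.trans ?_
    have : δ / (1 + T) * (1 + t) ≤ δ / (1 + T) * (1 + T) := by gcongr; exact ht.2
    rw [div_mul_cancel₀ _ (by positivity)] at this
    linarith
  have hlower : ∀ i, ∀ t ∈ Set.Icc 0 T, lo i ≤ y t i := by
    intro i t ht
    refine le_of_forall_pos_le_add fun δ hδ => ?_
    have hδ' : 0 < δ / (1 + T) := by positivity
    have := image_le_of_deriv_right_lt_deriv_boundary (a := 0) (b := T) (hyi i).neg
      (fun t ht => (hdr i t ht).neg)
      (B := fun t => -lo i + δ / (1 + T) * (1 + t)) (B' := fun _ => δ / (1 + T))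
      (by simp only [Pi.neg_apply]; rw [hy0]; have := hx.1 i; linarith)
      (fun t => by
        simpa using
          (((hasDerivAt_id t).const_add (1 : ℝ)).const_mul (δ / (1 + T))).const_add (-lo i))
      (fun t ht h1 => by
        simp only [Pi.neg_apply] at h1
        have h2 : y t i ≤ lo i := by
          have := mul_nonneg hδ'.le (by linarith [ht.1] : 0 ≤ 1 + t); linarith
        have h3 : boxProj lo hi (y t) i = lo i := by
          simp [boxProj, h2]
        rw [hfi, h3]
        have : lo i ≤ max (lo i) (min (hi i) (lo i + κ⁻¹ * G (boxProj lo hi (y t)) i)) :=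
          le_max_left _ _
        nlinarith) ht
    simp only [Pi.neg_apply] at this
    have h4 : δ / (1 + T) * (1 + t) ≤ δ / (1 + T) * (1 + T) := by gcongr; exact ht.2
    rw [div_mul_cancel₀ _ (by positivity)] at h4
    linarith
  have hbox : ∀ t ∈ Set.Icc 0 T, y t ∈ Set.Icc lo hi := fun t ht =>
    ⟨fun i => hlower i t ht, fun i => hupper i t ht⟩
  have hfc : ContinuousOn (fun t => f (y t)) (Set.Icc 0 T) := hK.continuous.comp_continuousOn hyc
  refine ⟨y, hy0, fun i => ?_, ?_⟩
  · have hfci : ContinuousOn (fun t => f (y t) i) (Set.Icc 0 T) := continuousOn_pi.1 hfc i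
    have hGci : ContinuousOn (fun t => G (y t) i) (Set.Icc 0 T) :=
      continuousOn_pi.1 (hG.continuous.comp_continuousOn hyc) i
    have hκG : ∀ g : ℝ, κ * (κ⁻¹ * g) = g := fun g => by field_simp
    refine IsReflected.of_eq_integral (w := fun t => f (y t) i) (hyi i)
      (fun t ht => ⟨hlower i t ht, hupper i t ht⟩)
      (ContinuousOn.intervalIntegrable (by rwa [Set.uIcc_of_le hT]))
      (ContinuousOn.intervalIntegrable (by rwa [Set.uIcc_of_le hT]))
      (fun t ht => ?_) (fun t ht hlt => ?_) (fun t ht hlt => ?_)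
    · have hsub : Set.Icc 0 t ⊆ Set.Icc 0 T := Set.Icc_subset_Icc_right ht.2
      rw [intervalIntegral.integral_eq_sub_of_hasDerivAt_of_le ht.1 ((hyi i).mono hsub)
        (fun s hs => (hd i s ⟨hs.1.le, hs.2.le.trans ht.2⟩).hasDerivAt
          (Icc_mem_nhds hs.1 (hs.2.trans_le ht.2)))
        (ContinuousOn.intervalIntegrable (by rw [Set.uIcc_of_le ht.1]; exact hfci.mono hsub))]
      ring
    · have := abs_le.1 (hGi _ (hbox t ht) i)
      rw [hfi, boxProj_of_mem (hbox t ht), ← hκG (G (y t) i)]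
      refine mul_le_mul_of_nonneg_left ?_ hκ.le
      rw [hκG, le_sub_iff_add_le']
      exact le_max_of_le_right (le_min (by linarith) le_rfl)
    · have := abs_le.1 (hGi _ (hbox t ht) i)
      rw [hfi, boxProj_of_mem (hbox t ht), ← hκG (G (y t) i)]
      refine mul_le_mul_of_nonneg_left ?_ hκ.le
      rw [hκG, sub_le_iff_le_add']
      exact max_le (by linarith) (min_le_right _ _)
  · exact (convex_Icc 0 T).lipschitzOnWith_of_nnnorm_hasDerivWithin_le hy fun t _ => hfM _

/-- The approximations with tolerance `1 / (n + 1)` on `[0, n]` form a Cauchy sequence by the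
stability of reflected solutions, and their limit is reflected without tolerance. -/
theorem exists_reflectedSolution (h : ∀ i, lo i ≤ hi i) {L M : NNReal}
    (hG : LipschitzWith L G) (hM : ∀ u ∈ Set.Icc lo hi, ‖G u‖ ≤ M)
    {x : Fin I → ℝ} (hx : x ∈ Set.Icc lo hi) :
    ∃ y : ℝ → Fin I → ℝ, y 0 = x ∧ (∀ T, IsReflectedSolution G lo hi 0 T y) ∧
      LipschitzOnWith M y (Set.Ici 0) := by
  set e : ℕ → ℝ := fun n => 1 / ((n : ℝ) + 1) with he
  have he0 : ∀ n, 0 < e n := fun n => by positivity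
  have helim : Tendsto e atTop (𝓝 0) := tendsto_one_div_add_atTop_nhds_zero_nat
  have hanti : ∀ {m n : ℕ}, m ≤ n → e n ≤ e m := fun hmn => by
    simp only [he]; gcongr
  choose Y hY0 hY hYL using fun n : ℕ =>
    exists_approx_reflectedSolution (T := n) h hG hM (he0 n) n.cast_nonneg hx
  have hdist : ∀ {T : ℝ} {m n : ℕ}, T ≤ m → m ≤ n → ∀ t ∈ Set.Icc 0 T,
      ‖Y n t - Y m t‖ ≤ e m * Real.exp (L * t) := fun {T m n} hT hmn =>
    ((hY n).mono (hT.trans (by exact_mod_cast hmn))).norm_sub_le ((hY m).mono hT) hG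
      (hanti hmn) le_rfl (by simp [hY0, (he0 m).le])
  have hcau : ∀ t, 0 ≤ t → ∃ z, Tendsto (fun n => Y n t) atTop (𝓝 z) := fun t ht => by
    refine cauchySeq_tendsto_of_complete (Metric.cauchySeq_iff'.2 fun δ hδ => ?_)
    have h1 : Tendsto (fun n => e n * Real.exp (L * t)) atTop (𝓝 0) := by
      simpa using helim.mul_const (Real.exp (L * t))
    obtain ⟨N, hN, hNt⟩ := ((h1.eventually_lt_const hδ).and
      (tendsto_natCast_atTop_atTop.eventually_ge_atTop t)).exists
    exact ⟨N, fun n hn => by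
      rw [dist_eq_norm]
      exact (hdist hNt hn t ⟨ht, le_rfl⟩).trans_lt hN⟩
  choose! y hy using hcau
  have hev : ∀ T : ℝ, ∀ᶠ n : ℕ in atTop, T ≤ n := fun T =>
    tendsto_natCast_atTop_atTop.eventually_ge_atTop T
  have hlip : LipschitzOnWith M y (Set.Ici 0) := LipschitzOnWith.of_dist_le_mul fun s hs t ht => by
    refine le_of_tendsto ((hy s hs).dist (hy t ht)) ?_
    filter_upwards [hev s, hev t] with n hns hnt
    exact (hYL n).dist_le_mul s ⟨hs, hns⟩ t ⟨ht, hnt⟩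
  have hclose : ∀ {T : ℝ} {m : ℕ}, T ≤ m → ∀ t ∈ Set.Icc 0 T,
      ‖y t - Y m t‖ ≤ e m * Real.exp (L * t) := fun {T m} hT t ht => by
    refine le_of_tendsto ((hy t ht.1).sub_const _).norm ?_
    filter_upwards [eventually_ge_atTop m] with n hn using hdist hT hn t ht
  have hyi : ∀ i t, 0 ≤ t → Tendsto (fun n => Y n t i) atTop (𝓝 (y t i)) := fun i t ht =>
    tendsto_pi_nhds.1 (hy t ht) i
  have hψ : ∀ i t, 0 ≤ t → Tendsto (fun n => ∫ s in (0 : ℝ)..t, G (Y n s) i) atTop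
      (𝓝 (∫ s in (0 : ℝ)..t, G (y s) i)) := fun i t ht => by
    have hGi : Continuous fun u => G u i := (continuous_apply i).comp hG.continuous
    refine intervalIntegral.tendsto_integral_filter_of_dominated_convergence (fun _ => (M : ℝ))
      ?_ ?_ (by simp) ?_
    · filter_upwards [hev t] with n hn
      refine (ContinuousOn.mono (hGi.comp_continuousOn (hY n).continuousOn)
        fun s hs => ?_).aestronglyMeasurable measurableSet_uIoc
      rw [Set.uIoc_of_le ht] at hs
      exact ⟨hs.1.le, hs.2.trans hn⟩
    · filter_upwards [hev t] with n hn
      refine Eventually.of_forall fun s hs => ?_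
      rw [Set.uIoc_of_le ht] at hs
      exact (norm_le_pi_norm _ i).trans (hM _ ((hY n).mem_box s ⟨hs.1.le, hs.2.trans hn⟩))
    · refine Eventually.of_forall fun s hs => ?_
      rw [Set.uIoc_of_le ht] at hs
      exact (hGi.tendsto _).comp (hy s hs.1.le)
  have hbox : ∀ t, 0 ≤ t → y t ∈ Set.Icc lo hi := fun t ht =>
    isClosed_Icc.mem_of_tendsto (hy t ht) (by
      filter_upwards [hev t] with n hn using (hY n).mem_box t ⟨ht, hn⟩)
  -- strict inequalities on a compact interval pass to the approximations
  have hunif : ∀ {s t : ℝ}, 0 ≤ s → s ≤ t → ∀ δ > 0, ∀ᶠ n in atTop,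
      ∀ r ∈ Set.Icc s t, ∀ i, |y r i - Y n r i| + e n < δ := fun {s t} hs hst δ hδ => by
    have h1 : Tendsto (fun n => e n * Real.exp (L * t) + e n) atTop (𝓝 0) := by
      simpa using (helim.mul_const (Real.exp (L * t))).add helim
    filter_upwards [h1.eventually_lt_const hδ, hev t] with n hn hnt r hr i
    refine lt_of_le_of_lt (add_le_add_left ?_ _) hn
    refine (norm_le_pi_norm (y r - Y n r) i).trans
      ((hclose hnt r ⟨hs.trans hr.1, hr.2⟩).trans ?_)
    have := (he0 n).le
    gcongr
    exact hr.2
  have hyc : ∀ i, ContinuousOn (fun t => y t i) (Set.Ici 0) := continuousOn_pi.1 hlip.continuousOn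
  refine ⟨y, tendsto_nhds_unique (hy 0 le_rfl) (by simp [hY0]), fun T i => ?_, hlip⟩
  refine ⟨(hyc i).mono Set.Icc_subset_Ici_self,
    fun t ht => ⟨(hbox t ht.1).1 i, (hbox t ht.1).2 i⟩, fun s t h0 hst hT hr => ?_,
    fun s t h0 hst hT hr => ?_⟩
  · obtain ⟨r₀, hr₀, hmax⟩ := isCompact_Icc.exists_isMaxOn (Set.nonempty_Icc.2 hst)
      ((hyc i).mono fun r hr => h0.trans hr.1)
    have hδ : 0 < hi i - y r₀ i := by have := hr r₀ hr₀; linarith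
    refine le_of_tendsto_of_tendsto ((hψ i t (h0.trans hst)).sub (hψ i s h0))
      ((hyi i t (h0.trans hst)).sub (hyi i s h0)) ?_
    filter_upwards [hunif h0 hst _ hδ, hev t] with n hn hnt
    refine (hY n i).le_sub s t h0 hst hnt fun r hr => ?_
    have h1 := hn r hr i
    have h2 : y r i ≤ y r₀ i := hmax hr
    have h3 := neg_abs_le (y r i - Y n r i)
    linarith
  · obtain ⟨r₀, hr₀, hmin⟩ := isCompact_Icc.exists_isMinOn (Set.nonempty_Icc.2 hst)
      ((hyc i).mono fun r hr => h0.trans hr.1)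
    have hδ : 0 < y r₀ i - lo i := by have := hr r₀ hr₀; linarith
    refine le_of_tendsto_of_tendsto ((hyi i t (h0.trans hst)).sub (hyi i s h0))
      ((hψ i t (h0.trans hst)).sub (hψ i s h0)) ?_
    filter_upwards [hunif h0 hst _ hδ, hev t] with n hn hnt
    refine (hY n i).sub_le s t h0 hst hnt fun r hr => ?_
    have h1 := hn r hr i
    have h2 : y r₀ i ≤ y r i := hmin hr
    have h3 := le_abs_self (y r i - Y n r i)
    linarith

end

/-! ### The flow of the projected equation -/

section

lemma right_deriv_le_of_le {f g : ℝ → ℝ} {f' g' t : ℝ} (hf : HasDerivAt f f' t)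
    (hg : HasDerivAt g g' t) (h : ∀ᶠ r in 𝓝[>] t, f r - f t ≤ g r - g t) : f' ≤ g' := by
  refine le_of_tendsto_of_tendsto (hasDerivWithinAt_iff_tendsto_slope' Set.self_notMem_Ioi |>.1
    hf.hasDerivWithinAt) (hasDerivWithinAt_iff_tendsto_slope' Set.self_notMem_Ioi |>.1
    hg.hasDerivWithinAt) ?_
  filter_upwards [h, self_mem_nhdsWithin] with r hr hrt
  rw [slope_def_field, slope_def_field]
  have : 0 < r - t := sub_pos.2 hrt
  gcongr

/-- At an interior end-point contact the derivative of the path vanishes, because the path has a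
local extremum there; off the end points the path follows its driving path. -/
lemma IsReflected.deriv_eq {lo hi T t v d : ℝ} {ψ y : ℝ → ℝ} (h : IsReflected lo hi 0 T ψ y)
    (hlh : lo < hi) (ht : t ∈ Set.Ioo 0 T) (hψ : HasDerivAt ψ v t) (hy : HasDerivAt y d t) :
    d = if y t ≤ lo then max v 0 else if hi ≤ y t then min v 0 else v := by
  have hnear : ∀ {p : ℝ → Prop}, (∀ᶠ r in 𝓝 t, p r) →
      ∀ᶠ b in 𝓝[>] t, b ≤ T ∧ ∀ r ∈ Set.Icc t b, p r := fun {p} hp => by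
    obtain ⟨b, hb, hbs⟩ := mem_nhdsGE_iff_exists_Icc_subset.1 (hp.filter_mono nhdsWithin_le_nhds)
    filter_upwards [Ioc_mem_nhdsGT hb, Ioc_mem_nhdsGT ht.2] with c hc hcT
    exact ⟨hcT.2, fun r hr => hbs ⟨hr.1, hr.2.trans hc.2⟩⟩
  have hA : y t < hi → v ≤ d := fun hlt => right_deriv_le_of_le hψ hy (by
    filter_upwards [hnear (hy.continuousAt.eventually_lt_const hlt), self_mem_nhdsWithin]
      with b hb htb
    exact h.le_sub t b ht.1.le (le_of_lt htb) hb.1 fun r hr => by linarith [hb.2 r hr])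
  have hB : lo < y t → d ≤ v := fun hlt => right_deriv_le_of_le hy hψ (by
    filter_upwards [hnear (hy.continuousAt.eventually_const_lt hlt), self_mem_nhdsWithin]
      with b hb htb
    exact h.sub_le t b ht.1.le (le_of_lt htb) hb.1 fun r hr => by linarith [hb.2 r hr])
  have hbox := h.mem_Icc t ⟨ht.1.le, ht.2.le⟩
  have hloc : ∀ᶠ r in 𝓝 t, y r ∈ Set.Icc lo hi := by
    filter_upwards [Ioo_mem_nhds ht.1 ht.2] with r hr using h.mem_Icc r ⟨hr.1.le, hr.2.le⟩
  split_ifs with h1 h2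
  · have hd : d = 0 := IsLocalMin.hasDerivAt_eq_zero
      (hloc.mono fun r hr => h1.trans hr.1) hy
    rw [hd, max_eq_right]
    rw [← hd]
    exact hA (h1.trans_lt hlh)
  · have hd : d = 0 := IsLocalMax.hasDerivAt_eq_zero
      (hloc.mono fun r hr => hr.2.trans h2) hy
    rw [hd, min_eq_right]
    rw [← hd]
    exact hB (not_le.1 h1)
  · exact le_antisymm (hB (not_le.1 h1)) (hA (not_le.1 h2))

variable {I : ℕ} {G : (Fin I → ℝ) → Fin I → ℝ} {lo hi : Fin I → ℝ}

/-- A Lipschitz reflected solution is absolutely continuous, so it is the integral of its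
derivative, which is almost everywhere the projected velocity. -/
theorem isProjSolution_of_isReflectedSolution (hlh : ∀ i, lo i < hi i) (hG : Continuous G)
    {M : NNReal} {y : ℝ → Fin I → ℝ} (hy : ∀ T, IsReflectedSolution G lo hi 0 T y)
    (hlip : LipschitzOnWith M y (Set.Ici 0)) : IsProjSolution G lo hi (y 0) y where
  initial := rfl
  continuousOn := hlip.continuousOn
  mem_box t ht := (hy t).mem_box t ⟨ht, le_rfl⟩
  eq_integral T hT i := by
    have hyc := hlip.continuousOn
    have hli : LipschitzOnWith M (fun t => y t i) (Set.uIcc 0 T) := by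
      refine LipschitzOnWith.of_dist_le_mul fun s hs t ht => ?_
      rw [Set.uIcc_of_le hT] at hs ht
      exact (dist_le_pi_dist (y s) (y t) i).trans (hlip.dist_le_mul s hs.1 t ht.1)
    have hac := hli.absolutelyContinuousOnInterval
    have hGc : ContinuousOn (fun t => G (y t) i) (Set.Ici 0) :=
      continuousOn_pi.1 (hG.comp_continuousOn hyc) i
    have hderiv : ∀ᵐ t, t ∈ Set.uIoc 0 T →
        deriv (fun t => y t i) t = projField lo hi (y t) (G (y t)) i := by
      filter_upwards [hac.ae_differentiableAt, (Set.countable_singleton T).ae_notMem volume]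
        with t h1 h2 ht
      have hd := h1 (Set.uIoc_subset_uIcc ht)
      rw [Set.uIoc_of_le hT] at ht
      have htT : t < T := lt_of_le_of_ne ht.2 h2
      have hnt : Set.Ici (0 : ℝ) ∈ 𝓝 t := Ici_mem_nhds ht.1
      have hψ : HasDerivAt (fun t => ∫ s in (0 : ℝ)..t, G (y s) i) (G (y t) i) t :=
        intervalIntegral.integral_hasDerivAt_right
          (ContinuousOn.intervalIntegrable (hGc.mono fun s hs => by
            rw [Set.uIcc_of_le ht.1.le] at hs; exact hs.1))
          (hGc.stronglyMeasurableAtFilter_nhdsWithin measurableSet_Ici t |>.filter_mono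
            (by rw [nhdsWithin_eq_nhds.2 hnt]))
          (hGc.continuousAt hnt)
      exact (hy T i).deriv_eq (hlh i) ⟨ht.1, htT⟩ hψ hd.hasDerivAt
    rw [← intervalIntegral.integral_congr_ae hderiv, hac.integral_deriv_eq_sub]
    ring

lemma abs_projField_le (x v : Fin I → ℝ) (i : Fin I) : |projField lo hi x v i| ≤ |v i| := by
  unfold projField
  split_ifs
  · rcases max_cases (v i) 0 with h | h <;> simp [h.1]
  · rcases min_cases (v i) 0 with h | h <;> simp [h.1]
  · rfl

theorem IsProjSolution.isReflectedSolution {x : Fin I → ℝ} {y : ℝ → Fin I → ℝ}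
    (hy : IsProjSolution G lo hi x y) (hG : Continuous G) {T : ℝ} (hT : 0 ≤ T) :
    IsReflectedSolution G lo hi 0 T y := fun i => by
  have hc : ContinuousOn y (Set.uIcc 0 T) := hy.continuousOn.mono fun s hs => by
    rw [Set.uIcc_of_le hT] at hs; exact hs.1
  have hGc : ContinuousOn (fun t => G (y t) i) (Set.uIcc 0 T) :=
    continuousOn_pi.1 (hG.comp_continuousOn hc) i
  have hint := hGc.intervalIntegrable (μ := volume)
  have hw : IntervalIntegrable (fun s => projField lo hi (y s) (G (y s)) i) volume 0 T := by
    refine hint.mono_fun ?_ (Eventually.of_forall fun s => abs_projField_le _ _ _)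
    let φ : ℝ × ℝ → ℝ := fun p =>
      if p.1 ≤ lo i then max p.2 0 else if hi i ≤ p.1 then min p.2 0 else p.2
    have hφ : Measurable φ :=
      Measurable.ite (measurableSet_le measurable_fst measurable_const)
        (measurable_snd.max measurable_const)
        (Measurable.ite (measurableSet_le measurable_const measurable_fst)
          (measurable_snd.min measurable_const) measurable_snd)
    have h1 : AEMeasurable (fun s => (y s i, G (y s) i)) (volume.restrict (Set.uIoc 0 T)) :=
      (((continuousOn_pi.1 hc i).prodMk hGc).mono Set.uIoc_subset_uIcc).aemeasurable
        measurableSet_uIoc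
    exact (hφ.comp_aemeasurable h1).aestronglyMeasurable
  have hbox : ∀ t ∈ Set.Icc 0 T, y t i ∈ Set.Icc (lo i) (hi i) := fun t ht =>
    ⟨(hy.mem_box t ht.1).1 i, (hy.mem_box t ht.1).2 i⟩
  refine IsReflected.of_eq_integral ((continuousOn_pi.1 hc i).mono Set.Icc_subset_uIcc) hbox
    hint hw (fun t ht => ?_) (fun t ht hlt => ?_) (fun t ht hlt => ?_)
  · rw [hy.initial]; exact hy.eq_integral t ht.1 i
  · rw [sub_zero] at hlt
    unfold projField
    rw [if_neg (not_le.2 hlt)]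
    split_ifs
    · exact le_max_left _ _
    · rfl
  · rw [add_zero] at hlt
    unfold projField
    rw [if_neg (not_le.2 hlt)]
    split_ifs
    · exact min_le_left _ _
    · rfl

lemma exists_norm_le_of_continuous (hG : Continuous G) :
    ∃ M : NNReal, ∀ u ∈ Set.Icc lo hi, ‖G u‖ ≤ M := by
  obtain ⟨M, hM⟩ := isCompact_Icc.exists_bound_of_continuousOn hG.continuousOn (s := Set.Icc lo hi)
  exact ⟨M.toNNReal, fun u hu => (hM u hu).trans (le_max_left _ _)⟩

/-- Reflected solutions with the same starting point coincide. -/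
lemma IsReflectedSolution.eq {T : ℝ} {y z : ℝ → Fin I → ℝ} {L : NNReal}
    (hy : IsReflectedSolution G lo hi 0 T y) (hz : IsReflectedSolution G lo hi 0 T z)
    (hG : LipschitzWith L G) (h0 : y 0 = z 0) : ∀ t ∈ Set.Icc 0 T, y t = z t := fun t ht => by
  have := hy.norm_sub_le hz hG le_rfl le_rfl (by simp [h0]) t ht
  rw [zero_mul] at this
  exact sub_eq_zero.1 (norm_le_zero_iff.1 this)

theorem exists_isProjFlow (hlh : ∀ i, lo i < hi i) {L : NNReal} (hG : LipschitzWith L G) :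
    ∃ Φ, IsProjFlow G lo hi Φ := by
  obtain ⟨M, hM⟩ := exists_norm_le_of_continuous (lo := lo) (hi := hi) hG.continuous
  choose! Y hY0 hY hYL using fun x (hx : x ∈ Set.Icc lo hi) =>
    exists_reflectedSolution (fun i => (hlh i).le) hG hM hx
  refine ⟨fun t x => Y x t, fun x hx => ⟨?_, fun y hy t ht => ?_⟩⟩
  · have := isProjSolution_of_isReflectedSolution hlh hG.continuous (hY x hx) (hYL x hx)
    rwa [hY0 x hx] at this
  · exact (hy.isReflectedSolution hG.continuous ht).eq (hY x hx t) hG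
      (by rw [hy.initial, hY0 x hx]) t ⟨ht, le_rfl⟩

variable {Φ : ℝ → (Fin I → ℝ) → Fin I → ℝ}

lemma IsProjFlow.isReflectedSolution (hΦ : IsProjFlow G lo hi Φ) (hG : Continuous G)
    {x : Fin I → ℝ} (hx : x ∈ Set.Icc lo hi) {T : ℝ} (hT : 0 ≤ T) :
    IsReflectedSolution G lo hi 0 T (fun t => Φ t x) :=
  (hΦ x hx).1.isReflectedSolution hG hT

lemma IsProjFlow.eq_of_isReflectedSolution (hΦ : IsProjFlow G lo hi Φ) {L : NNReal}
    (hG : LipschitzWith L G) {T : ℝ} {y : ℝ → Fin I → ℝ}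
    (hy : IsReflectedSolution G lo hi 0 T y) : ∀ t ∈ Set.Icc 0 T, Φ t (y 0) = y t := fun t ht => by
  have h0 : y 0 ∈ Set.Icc lo hi := hy.mem_box 0 ⟨le_rfl, ht.1.trans ht.2⟩
  exact (hΦ.isReflectedSolution hG.continuous h0 (ht.1.trans ht.2)).eq hy hG
    (hΦ _ h0).1.initial t ht

theorem IsProjFlow.eq_of_isIntegralCurveOn (hΦ : IsProjFlow G lo hi Φ) {L : NNReal}
    (hG : LipschitzWith L G) {T : ℝ} (hT : 0 ≤ T) {y : ℝ → Fin I → ℝ}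
    (hy : IsIntegralCurveOn y (fun _ => G) (Set.Icc 0 T))
    (hbox : ∀ t ∈ Set.Icc 0 T, y t ∈ Set.Icc lo hi) : ∀ t ∈ Set.Icc 0 T, Φ t (y 0) = y t := by
  refine hΦ.eq_of_isReflectedSolution hG fun i => ?_
  have hc : ContinuousOn y (Set.Icc 0 T) := hy.continuousOn
  have hGc : ContinuousOn (fun t => G (y t) i) (Set.Icc 0 T) :=
    continuousOn_pi.1 (hG.continuous.comp_continuousOn hc) i
  have hint : IntervalIntegrable (fun t => G (y t) i) volume 0 T :=
    ContinuousOn.intervalIntegrable (by rwa [Set.uIcc_of_le hT])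
  refine IsReflected.of_eq_integral (continuousOn_pi.1 hc i)
    (fun t ht => ⟨(hbox t ht).1 i, (hbox t ht).2 i⟩) hint hint (fun t ht => ?_)
    (fun _ _ _ => le_rfl) (fun _ _ _ => le_rfl)
  have hsub : Set.Icc 0 t ⊆ Set.Icc 0 T := Set.Icc_subset_Icc_right ht.2
  rw [intervalIntegral.integral_eq_sub_of_hasDerivAt_of_le ht.1
    ((continuousOn_pi.1 hc i).mono hsub)
    (fun s hs => (hasDerivWithinAt_pi.1 (hy s ⟨hs.1.le, hs.2.le.trans ht.2⟩) i).hasDerivAt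
      (Icc_mem_nhds hs.1 (hs.2.trans_le ht.2)))
    (ContinuousOn.intervalIntegrable (by rw [Set.uIcc_of_le ht.1]; exact hGc.mono hsub))]
  ring

/-- `Φ` is a semiflow on the set `S`, Lipschitz continuous in time with constant `M` and in the
initial value with constant `exp (L t)` at time `t`. -/
structure IsLipschitzSemiflow (Φ : ℝ → (Fin I → ℝ) → Fin I → ℝ) (S : Set (Fin I → ℝ))
    (L M : NNReal) : Prop where
  zero : ∀ x ∈ S, Φ 0 x = x
  mem : ∀ x ∈ S, ∀ t, 0 ≤ t → Φ t x ∈ S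
  add : ∀ x ∈ S, ∀ s t, 0 ≤ s → 0 ≤ t → Φ (s + t) x = Φ t (Φ s x)
  dist_space : ∀ x ∈ S, ∀ y ∈ S, ∀ t, 0 ≤ t → dist (Φ t x) (Φ t y) ≤ dist x y * Real.exp (L * t)
  dist_time : ∀ x ∈ S, ∀ s t, 0 ≤ s → 0 ≤ t → dist (Φ s x) (Φ t x) ≤ M * |s - t|

lemma IsReflectedSolution.shift {T s : ℝ} {y : ℝ → Fin I → ℝ}
    (hy : IsReflectedSolution G lo hi 0 (s + T) y) (hG : Continuous G) (hs : 0 ≤ s) :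
    IsReflectedSolution G lo hi 0 T (fun t => y (s + t)) := fun i => by
  have hψ : ∀ t ∈ Set.Icc 0 T, ∫ r in (0 : ℝ)..t, G (y (s + r)) i =
      (∫ r in (0 : ℝ)..(s + t), G (y r) i) - ∫ r in (0 : ℝ)..s, G (y r) i := fun t ht => by
    have hGc : ContinuousOn (fun t => G (y t) i) (Set.Icc 0 (s + T)) :=
      continuousOn_pi.1 (hG.comp_continuousOn hy.continuousOn) i
    have hi' : ∀ b, 0 ≤ b → b ≤ s + T → IntervalIntegrable (fun t => G (y t) i) volume 0 b :=
      fun b h0 h1 => ContinuousOn.intervalIntegrable (by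
        rw [Set.uIcc_of_le h0]; exact hGc.mono (Set.Icc_subset_Icc_right h1))
    rw [intervalIntegral.integral_interval_sub_left
        (hi' _ (add_nonneg hs ht.1) (by linarith [ht.2])) (hi' _ hs (by linarith [ht.1, ht.2])),
      intervalIntegral.integral_comp_add_left (fun r => G (y r) i), add_zero]
  have hmaps : ∀ t ∈ Set.Icc 0 T, s + t ∈ Set.Icc 0 (s + T) := fun t ht =>
    ⟨add_nonneg hs ht.1, by linarith [ht.2]⟩
  have hr' : ∀ {p : ℝ → Prop} {a b : ℝ}, (∀ r ∈ Set.Icc a b, p (y (s + r) i)) →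
      ∀ r ∈ Set.Icc (s + a) (s + b), p (y r i) := fun {p a b} h r hr => by
    have := h (r - s) ⟨by linarith [hr.1], by linarith [hr.2]⟩
    rwa [add_sub_cancel] at this
  refine ⟨(hy i).continuousOn.comp (by fun_prop) hmaps, fun t ht => (hy i).mem_Icc _ (hmaps t ht),
    fun a b ha hab hb h => ?_, fun a b ha hab hb h => ?_⟩
  · rw [hψ a ⟨ha, hab.trans hb⟩, hψ b ⟨ha.trans hab, hb⟩, sub_sub_sub_cancel_right]
    exact (hy i).le_sub _ _ (add_nonneg hs ha) (by linarith) (by linarith)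
      (hr' (p := fun z => z < hi i - 0) h)
  · rw [hψ a ⟨ha, hab.trans hb⟩, hψ b ⟨ha.trans hab, hb⟩, sub_sub_sub_cancel_right]
    exact (hy i).sub_le _ _ (add_nonneg hs ha) (by linarith) (by linarith)
      (hr' (p := fun z => lo i + 0 < z) h)

theorem IsProjFlow.isLipschitzSemiflow (hΦ : IsProjFlow G lo hi Φ) (hlh : ∀ i, lo i < hi i)
    {L M : NNReal} (hG : LipschitzWith L G) (hM : ∀ u ∈ Set.Icc lo hi, ‖G u‖ ≤ M) :
    IsLipschitzSemiflow Φ (Set.Icc lo hi) L M where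
  zero x hx := (hΦ x hx).1.initial
  mem x hx t ht := (hΦ x hx).1.mem_box t ht
  add x hx s t hs ht := by
    have h := ((hΦ.isReflectedSolution hG.continuous hx (add_nonneg hs ht)).shift hG.continuous hs)
    have := hΦ.eq_of_isReflectedSolution hG h t ⟨ht, le_rfl⟩
    simp only [add_zero] at this
    exact this.symm
  dist_space x hx y hy t ht := by
    rw [dist_eq_norm, dist_eq_norm]
    exact (hΦ.isReflectedSolution hG.continuous hx ht).norm_sub_le
      (hΦ.isReflectedSolution hG.continuous hy ht) hG (norm_nonneg _) (norm_nonneg _)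
      (by rw [(hΦ x hx).1.initial, (hΦ y hy).1.initial]) t ⟨ht, le_rfl⟩
  dist_time x hx s t hs ht := by
    obtain ⟨y, hy0, hy, hyL⟩ := exists_reflectedSolution (fun i => (hlh i).le) hG hM hx
    have h : ∀ r, 0 ≤ r → Φ r x = y r := fun r hr => by
      have := hΦ.eq_of_isReflectedSolution hG (hy r) r ⟨hr, le_rfl⟩
      rwa [hy0] at this
    rw [h s hs, h t ht, ← Real.dist_eq]
    exact hyL.dist_le_mul s hs t ht

end

/-! ### The iterates track the flow -/

section

/-- Comparison of a projected recursion `u` with a reflected path `z` that varies by at most `E`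
in each time step. With `j` the last index before `m` at which `u j - z (τ j) ≤ E`, the recursion
stays off `lo` and the path stays off `hi` from `j` on. -/
lemma exists_sub_le_of_isReflected {lo hi E : ℝ} {u δ τ : ℕ → ℝ} {ψ z : ℝ → ℝ} {n : ℕ}
    (hz : ∀ T, IsReflected lo hi 0 T ψ z) (hu : ∀ k, n ≤ k → u (k + 1) ≤ hi)
    (hstep : ∀ k, n ≤ k → lo < u (k + 1) → u (k + 1) ≤ u k + δ k)
    (hτ0 : ∀ k, n ≤ k → 0 ≤ τ k) (hτ : ∀ k, n ≤ k → τ k ≤ τ (k + 1))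
    (hE : ∀ k, n ≤ k → ∀ r ∈ Set.Icc (τ k) (τ (k + 1)), z r - z (τ (k + 1)) ≤ E)
    (h0 : u n - z (τ n) ≤ E) {m : ℕ} (hm : n ≤ m) :
    ∃ j, n ≤ j ∧ j ≤ m ∧
      u m - z (τ m) ≤ E + ((∑ k ∈ Finset.Ico j m, δ k) - (ψ (τ m) - ψ (τ j))) := by
  induction m, hm using Nat.le_induction with
  | base => exact ⟨n, le_rfl, le_rfl, by simpa using h0⟩
  | succ m hm ih =>
    by_cases hlt : u (m + 1) - z (τ (m + 1)) ≤ E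
    · exact ⟨m + 1, by lia, le_rfl, by simpa using hlt⟩
    obtain ⟨j, hnj, hjm, hj⟩ := ih
    rw [not_le] at hlt
    have hE0 : 0 ≤ E := by simpa using hE m hm (τ (m + 1)) ⟨hτ m hm, le_rfl⟩
    have hτm := hτ0 (m + 1) (by lia)
    have h1 : lo < u (m + 1) := by
      have := ((hz (τ (m + 1))).mem_Icc _ ⟨hτm, le_rfl⟩).1
      linarith
    have h2 := (hz (τ (m + 1))).le_sub (τ m) (τ (m + 1)) (hτ0 m hm) (hτ m hm) le_rfl
      fun r hr => by
        have := hE m hm r hr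
        have := hu m hm
        linarith
    have h3 := hstep m hm h1
    refine ⟨j, hnj, by lia, ?_⟩
    rw [Finset.sum_Ico_succ_top hjm]
    linarith

/-- The mirror image of the comparison with a projected recursion. -/
lemma exists_sub_le_of_isReflected' {lo hi E : ℝ} {u δ τ : ℕ → ℝ} {ψ z : ℝ → ℝ} {n : ℕ}
    (hz : ∀ T, IsReflected lo hi 0 T ψ z) (hu : ∀ k, n ≤ k → lo ≤ u (k + 1))
    (hstep : ∀ k, n ≤ k → u (k + 1) < hi → u k + δ k ≤ u (k + 1))
    (hτ0 : ∀ k, n ≤ k → 0 ≤ τ k) (hτ : ∀ k, n ≤ k → τ k ≤ τ (k + 1))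
    (hE : ∀ k, n ≤ k → ∀ r ∈ Set.Icc (τ k) (τ (k + 1)), z (τ (k + 1)) - z r ≤ E)
    (h0 : z (τ n) - u n ≤ E) {m : ℕ} (hm : n ≤ m) :
    ∃ j, n ≤ j ∧ j ≤ m ∧
      z (τ m) - u m ≤ E - ((∑ k ∈ Finset.Ico j m, δ k) - (ψ (τ m) - ψ (τ j))) := by
  have hz' : ∀ T, IsReflected (-hi) (-lo) 0 T (fun t => -ψ t) (fun t => -z t) := fun T =>
    ⟨(hz T).continuousOn.neg, fun t ht => by
        have := (hz T).mem_Icc t ht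
        exact ⟨neg_le_neg this.2, neg_le_neg this.1⟩,
      fun s t h1 h2 h3 h4 => by
        have := (hz T).sub_le s t h1 h2 h3 fun r hr => by have := h4 r hr; linarith
        linarith,
      fun s t h1 h2 h3 h4 => by
        have := (hz T).le_sub s t h1 h2 h3 fun r hr => by have := h4 r hr; linarith
        linarith⟩
  obtain ⟨j, h1, h2, h3⟩ := exists_sub_le_of_isReflected (u := fun k => -u k) (δ := fun k => -δ k)
    (τ := τ) (E := E) hz' (fun k hk => neg_le_neg (hu k hk))
    (fun k hk h => by have := hstep k hk (by linarith); linarith) hτ0 hτ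
    (fun k hk r hr => by have := hE k hk r hr; linarith) (by linarith) hm
  refine ⟨j, h1, h2, ?_⟩
  rw [Finset.sum_neg_distrib] at h3
  linarith

/-- Discrete Gronwall inequality in summed form. -/
lemma le_mul_exp_of_le_add_sum {a b : ℕ → ℝ} {c : ℝ} {n : ℕ} (hb : ∀ k, n ≤ k → 0 ≤ b k)
    (hc : 0 ≤ c) (ha : ∀ m, n ≤ m → a m ≤ c + ∑ k ∈ Finset.Ico n m, b k * a k) {m : ℕ}
    (hm : n ≤ m) : a m ≤ c * Real.exp (∑ k ∈ Finset.Ico n m, b k) := by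
  refine (ha m hm).trans ?_
  induction m, hm using Nat.le_induction with
  | base => simp
  | succ m hm ih =>
    rw [Finset.sum_Ico_succ_top hm, Finset.sum_Ico_succ_top hm, Real.exp_add]
    have h1 := mul_le_mul_of_nonneg_left (ha m hm) (hb m hm)
    have h2 := mul_le_mul_of_nonneg_left ih (hb m hm)
    have h3 := Real.add_one_le_exp (b m)
    have h4 : 0 ≤ c * Real.exp (∑ k ∈ Finset.Ico n m, b k) :=
      mul_nonneg hc (Real.exp_pos _).le
    nlinarith [mul_le_mul_of_nonneg_left h3 h4]

lemma sum_Ico_eq_stepTime_sub (ε : ℕ → ℝ) {j m : ℕ} (h : j ≤ m) :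
    ∑ k ∈ Finset.Ico j m, ε k = stepTime ε m - stepTime ε j :=
  Finset.sum_Ico_eq_sub _ h

lemma stepTime_succ (ε : ℕ → ℝ) (k : ℕ) : stepTime ε (k + 1) = stepTime ε k + ε k :=
  Finset.sum_range_succ _ _

lemma stepTime_mono {ε : ℕ → ℝ} (hε : ∀ k, 0 < ε k) : Monotone (stepTime ε) :=
  monotone_nat_of_le_succ fun k => by rw [stepTime_succ]; linarith [hε k]

variable {I : ℕ} {G : (Fin I → ℝ) → Fin I → ℝ} {lo hi : Fin I → ℝ}
  {Φ : ℝ → (Fin I → ℝ) → Fin I → ℝ}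

/-- From the index `n` on, the scheme with steps at most `h` and accumulated noise at most `η` stays
near the trajectory of the flow that starts at the `n`-th iterate. -/
theorem IsProjFlow.dist_le_of_recursion (hΦ : IsProjFlow G lo hi Φ) (hlh : ∀ i, lo i < hi i)
    {L M : NNReal} (hG : LipschitzWith L G) (hM : ∀ u ∈ Set.Icc lo hi, ‖G u‖ ≤ M)
    {ε : ℕ → ℝ} (hε : ∀ k, 0 < ε k) {θ W : ℕ → Fin I → ℝ}
    (hθ : ∀ k, θ (k + 1) = boxProj lo hi (θ k + ε k • (G (θ k) + W k))) {n : ℕ}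
    (hn : θ n ∈ Set.Icc lo hi) {h η : ℝ} (hεh : ∀ k, n ≤ k → ε k ≤ h)
    (hη : 0 ≤ η)
    (hW : ∀ i j m, n ≤ j → j ≤ m → |∑ k ∈ Finset.Ico j m, ε k * W k i| ≤ η) {m : ℕ} (hm : n ≤ m) :
    dist (θ m) (Φ (stepTime ε m - stepTime ε n) (θ n)) ≤
      (2 * M * h + η) * Real.exp (L * (stepTime ε m - stepTime ε n)) := by
  have hflow := hΦ.isLipschitzSemiflow hlh hG hM
  have hlh' : ∀ i, lo i ≤ hi i := fun i => (hlh i).le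
  set τ : ℕ → ℝ := fun k => stepTime ε k - stepTime ε n with hτdef
  set z : ℝ → Fin I → ℝ := fun t => Φ t (θ n) with hz
  have hτ0 : ∀ k, n ≤ k → 0 ≤ τ k := fun k hk => sub_nonneg.2 (stepTime_mono hε hk)
  have hτs : ∀ k, τ (k + 1) = τ k + ε k := fun k => by simp only [hτdef, stepTime_succ]; ring
  have hτ : ∀ k, n ≤ k → τ k ≤ τ (k + 1) := fun k _ => by rw [hτs]; linarith [hε k]
  have hτn : τ n = 0 := sub_self _
  have hh : 0 ≤ h := (hε n).le.trans (hεh n le_rfl)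
  have hMh : 0 ≤ M * h := mul_nonneg M.2 hh
  have hbox : ∀ k, n ≤ k → θ k ∈ Set.Icc lo hi := fun k hk => by
    rcases hk.eq_or_lt with rfl | hlt
    · exact hn
    · obtain ⟨k, rfl⟩ : ∃ l, k = l + 1 := ⟨k - 1, by lia⟩
      rw [hθ]; exact boxProj_mem hlh' _
  have hzbox : ∀ t, 0 ≤ t → z t ∈ Set.Icc lo hi := fun t ht => hflow.mem _ hn t ht
  have hzlip : ∀ k, n ≤ k → ∀ r ∈ Set.Icc (τ k) (τ (k + 1)), ∀ s ∈ Set.Icc (τ k) (τ (k + 1)),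
      dist (z r) (z s) ≤ M * h := fun k hk r hr s hs => by
    refine (hflow.dist_time _ hn r s ((hτ0 k hk).trans hr.1) ((hτ0 k hk).trans hs.1)).trans ?_
    refine mul_le_mul_of_nonneg_left ?_ M.2
    rw [hτs] at hr hs
    have := hεh k hk
    exact abs_le.2 ⟨by linarith [hr.1, hs.2], by linarith [hr.2, hs.1]⟩
  have hzr : ∀ T, 0 ≤ T → IsReflectedSolution G lo hi 0 T z := fun T hT =>
    hΦ.isReflectedSolution hG.continuous hn hT
  have hzr' : ∀ i T, IsReflected (lo i) (hi i) 0 T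
      (fun t => ∫ s in (0 : ℝ)..t, G (z s) i) (fun t => z t i) := fun i T =>
    (hzr (max T 0) (le_max_right _ _)).mono (le_max_left _ _) i
  have hzc : ContinuousOn z (Set.Ici 0) := (hΦ _ hn).1.continuousOn
  have hGz : ∀ i, ∀ a b, 0 ≤ a → a ≤ b →
      IntervalIntegrable (fun s => G (z s) i) volume a b := fun i a b ha hab =>
    ContinuousOn.intervalIntegrable (((continuous_apply i).comp hG.continuous).comp_continuousOn
      (hzc.mono fun s hs => by rw [Set.uIcc_of_le hab] at hs; exact ha.trans hs.1))
  set a : ℕ → ℝ := fun k => dist (θ k) (z (τ k)) with ha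
  -- the drift of one step of the scheme against that of the flow
  have hdrift : ∀ i k, n ≤ k →
      |ε k * G (θ k) i - ∫ s in (τ k)..(τ (k + 1)), G (z s) i| ≤
        L * ε k * (a k + M * h) := fun i k hk => by
    have h1 : ε k * G (θ k) i = ∫ s in (τ k)..(τ (k + 1)), G (θ k) i := by
      rw [intervalIntegral.integral_const, hτs]; simp
    rw [h1, ← intervalIntegral.integral_sub (by simp) (hGz i _ _ (hτ0 k hk) (hτ k hk))]
    have h2 := intervalIntegral.norm_integral_le_of_norm_le_const (a := τ k) (b := τ (k + 1))
      (f := fun s => G (θ k) i - G (z s) i) (C := L * (a k + M * h)) fun s hs => by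
        rw [Set.uIoc_of_le (hτ k hk)] at hs
        have h3 : dist (θ k) (z s) ≤ a k + M * h := (dist_triangle _ (z (τ k)) _).trans
          (add_le_add_right (hzlip k hk _ ⟨le_rfl, hτ k hk⟩ _ ⟨hs.1.le, hs.2⟩) _)
        calc ‖G (θ k) i - G (z s) i‖ ≤ ‖G (θ k) - G (z s)‖ :=
              norm_le_pi_norm (G (θ k) - G (z s)) i
          _ ≤ L * ‖θ k - z s‖ := hG.norm_sub_le _ _
          _ ≤ _ := by rw [← dist_eq_norm]; gcongr
    rw [Real.norm_eq_abs, hτs, add_sub_cancel_left, abs_of_pos (hε k)] at h2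
    rw [hτs]
    linarith
  have hsum : ∀ i j m, n ≤ j → j ≤ m →
      |(∑ k ∈ Finset.Ico j m, ε k * (G (θ k) i + W k i)) -
        ((∫ s in (0 : ℝ)..(τ m), G (z s) i) - ∫ s in (0 : ℝ)..(τ j), G (z s) i)| ≤
          η + ∑ k ∈ Finset.Ico n m, L * ε k * (a k + M * h) := fun i j m hj hjm => by
    have hτj : τ j ≤ τ m := sub_le_sub_right (stepTime_mono hε hjm) _
    have hint : (∫ s in (0 : ℝ)..(τ m), G (z s) i) - ∫ s in (0 : ℝ)..(τ j), G (z s) i =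
        ∑ k ∈ Finset.Ico j m, ∫ s in (τ k)..(τ (k + 1)), G (z s) i := by
      rw [intervalIntegral.sum_integral_adjacent_intervals_Ico hjm fun k hk =>
          hGz i _ _ (hτ0 k (hj.trans hk.1)) (hτ k (hj.trans hk.1)),
        intervalIntegral.integral_interval_sub_left
          (hGz i _ _ le_rfl (hτ0 m (hj.trans hjm))) (hGz i _ _ le_rfl (hτ0 j hj))]
    have hsplit : (∑ k ∈ Finset.Ico j m, ε k * (G (θ k) i + W k i)) -
        ((∫ s in (0 : ℝ)..(τ m), G (z s) i) - ∫ s in (0 : ℝ)..(τ j), G (z s) i) =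
        (∑ k ∈ Finset.Ico j m, ε k * W k i) + ∑ k ∈ Finset.Ico j m,
          (ε k * G (θ k) i - ∫ s in (τ k)..(τ (k + 1)), G (z s) i) := by
      rw [hint, ← Finset.sum_sub_distrib, ← Finset.sum_add_distrib]
      exact Finset.sum_congr rfl fun k _ => by ring
    rw [hsplit]
    refine (abs_add_le _ _).trans (add_le_add (hW i j m hj hjm) ?_)
    refine (Finset.abs_sum_le_sum_abs _ _).trans ?_
    refine (Finset.sum_le_sum fun k hk =>
      hdrift i k (hj.trans (Finset.mem_Ico.1 hk).1)).trans ?_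
    refine Finset.sum_le_sum_of_subset_of_nonneg (Finset.Ico_subset_Ico_left hj) fun k hk _ => ?_
    exact mul_nonneg (mul_nonneg L.2 (hε k).le) (add_nonneg dist_nonneg hMh)
  have hmain : ∀ m, n ≤ m → a m + M * h ≤
      (2 * M * h + η) + ∑ k ∈ Finset.Ico n m, L * ε k * (a k + M * h) := fun m hm => by
    have hS : 0 ≤ ∑ k ∈ Finset.Ico n m, L * ε k * (a k + M * h) :=
      Finset.sum_nonneg fun k _ =>
        mul_nonneg (mul_nonneg L.2 (hε k).le) (add_nonneg dist_nonneg hMh)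
    suffices a m ≤ M * h + (η + ∑ k ∈ Finset.Ico n m, L * ε k * (a k + M * h)) by linarith
    refine (dist_pi_le_iff (by positivity)).2 fun i => ?_
    have hθi : ∀ k, θ (k + 1) i =
        max (lo i) (min (hi i) (θ k i + ε k * (G (θ k) i + W k i))) := fun k => by
      rw [hθ]; rfl
    have hz0 : z (τ n) = θ n := by rw [hτn]; exact (hΦ _ hn).1.initial
    have hEi : ∀ k, n ≤ k → ∀ r ∈ Set.Icc (τ k) (τ (k + 1)),
        |z r i - z (τ (k + 1)) i| ≤ M * h := fun k hk r hr =>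
      (dist_le_pi_dist (z r) (z (τ (k + 1))) i).trans (hzlip k hk r hr _ ⟨hτ k hk, le_rfl⟩)
    rw [Real.dist_eq, abs_le']
    constructor
    · obtain ⟨j, hj, hjm, hle⟩ := exists_sub_le_of_isReflected (u := fun k => θ k i)
        (δ := fun k => ε k * (G (θ k) i + W k i)) (τ := τ) (E := M * h) (hzr' i)
        (fun k hk => (hbox (k + 1) (by lia)).2 i)
        (fun k hk hlt => by
          rw [hθi] at hlt ⊢
          rw [max_eq_right ((lt_max_iff.1 hlt).resolve_left (lt_irrefl _)).le]
          exact min_le_right _ _)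
        hτ0 hτ (fun k hk r hr => (le_abs_self _).trans (hEi k hk r hr))
        (by rw [hz0]; simpa using hMh) hm
      have := le_abs_self _ |>.trans (hsum i j m hj hjm)
      linarith
    · obtain ⟨j, hj, hjm, hle⟩ := exists_sub_le_of_isReflected' (u := fun k => θ k i)
        (δ := fun k => ε k * (G (θ k) i + W k i)) (τ := τ) (E := M * h) (hzr' i)
        (fun k hk => (hbox (k + 1) (by lia)).1 i)
        (fun k hk hlt => by
          rw [hθi] at hlt ⊢
          refine le_max_of_le_right ?_
          have := (min_lt_iff.1 ((le_max_right _ _).trans_lt hlt)).resolve_left (lt_irrefl _)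
          exact le_min this.le le_rfl)
        hτ0 hτ (fun k hk r hr => by
          have := neg_abs_le (z r i - z (τ (k + 1)) i)
          have := hEi k hk r hr
          linarith)
        (by rw [hz0]; simpa using hMh) hm
      have := neg_abs_le _ |>.trans' (neg_le_neg (hsum i j m hj hjm))
      linarith
  have hgron := le_mul_exp_of_le_add_sum (a := fun k => a k + M * h) (b := fun k => L * ε k)
    (fun k _ => mul_nonneg L.2 (hε k).le) (by nlinarith : 0 ≤ 2 * M * h + η) hmain hm
  rw [← Finset.mul_sum, sum_Ico_eq_stepTime_sub ε hm] at hgron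
  exact (le_add_of_nonneg_right hMh).trans hgron

/-- On every bounded time window the sequence `θ`, at the times `stepTime ε`, tracks `Φ`. -/
def Tracks (Φ : ℝ → (Fin I → ℝ) → Fin I → ℝ) (ε : ℕ → ℝ) (θ : ℕ → Fin I → ℝ) : Prop :=
  ∀ T δ : ℝ, 0 < T → 0 < δ → ∀ᶠ n in atTop, ∀ m, n ≤ m → stepTime ε m - stepTime ε n ≤ T →
    dist (θ m) (Φ (stepTime ε m - stepTime ε n) (θ n)) ≤ δ

/-- The scheme tracks the flow if its steps tend to zero and its accumulated noise converges. -/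
theorem IsProjFlow.tracks (hΦ : IsProjFlow G lo hi Φ) (hlh : ∀ i, lo i < hi i)
    {L : NNReal} (hG : LipschitzWith L G) {ε : ℕ → ℝ} (hε : ∀ k, 0 < ε k)
    (hε0 : Tendsto ε atTop (𝓝 0)) {θ W : ℕ → Fin I → ℝ}
    (hθ : ∀ k, θ (k + 1) = boxProj lo hi (θ k + ε k • (G (θ k) + W k)))
    (hW : ∀ i, ∃ c, Tendsto (fun n => ∑ k ∈ Finset.range n, ε k * W k i) atTop (𝓝 c)) :
    Tracks Φ ε θ := by
  intro T δ hT hδ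
  obtain ⟨M, hM⟩ := exists_norm_le_of_continuous (lo := lo) (hi := hi) hG.continuous
  obtain ⟨κ, hκ, hκδ⟩ : ∃ κ : ℝ, 0 < κ ∧ (2 * M * κ + κ) * Real.exp (L * T) ≤ δ :=
    ⟨δ / ((2 * M + 1) * Real.exp (L * T)), by positivity, by
      have : (2 * (M : ℝ) + 1) * Real.exp (L * T) ≠ 0 := by positivity
      refine le_of_eq ?_
      field_simp⟩
  have hWc : ∀ᶠ n in atTop, ∀ i j m, n ≤ j → j ≤ m →
      |∑ k ∈ Finset.Ico j m, ε k * W k i| ≤ κ := by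
    have h1 : ∀ i, ∀ᶠ n in atTop, ∀ j m, n ≤ j → j ≤ m →
        |∑ k ∈ Finset.Ico j m, ε k * W k i| ≤ κ := fun i => by
      obtain ⟨c, hc⟩ := hW i
      obtain ⟨n, hn⟩ := Metric.cauchySeq_iff.1 hc.cauchySeq κ hκ
      filter_upwards [eventually_ge_atTop n] with n' hn' j m hj hjm
      rw [Finset.sum_Ico_eq_sub _ hjm]
      exact (hn m (by lia) j (by lia)).le
    filter_upwards [eventually_all.2 h1] with n hn i using hn i
  have hεc : ∀ᶠ n in atTop, ∀ k, n ≤ k → ε k ≤ κ :=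
    (eventually_atTop.1 (hε0.eventually_le_const hκ)).elim fun n hn => by
      filter_upwards [eventually_ge_atTop n] with n' hn' k hk using hn k (hn'.trans hk)
  filter_upwards [hWc, hεc, eventually_ge_atTop 1] with n h1 h2 h3 m hm hmT
  have hn : θ n ∈ Set.Icc lo hi := by
    obtain ⟨k, rfl⟩ : ∃ l, n = l + 1 := ⟨n - 1, by lia⟩
    rw [hθ]; exact boxProj_mem (fun i => (hlh i).le) _
  refine (hΦ.dist_le_of_recursion hlh hG hM hε hθ hn h2 hκ.le h1 hm).trans
    (le_trans ?_ hκδ)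
  gcongr

end

/-! ### Limit sets and asymptotically stable sets of a tracking sequence -/

section

variable {I : ℕ} {Φ : ℝ → (Fin I → ℝ) → Fin I → ℝ} {S : Set (Fin I → ℝ)} {L M : NNReal}
  {ε : ℕ → ℝ} {θ : ℕ → Fin I → ℝ}

lemma stepTime_strictMono (hε : ∀ k, 0 < ε k) : StrictMono (stepTime ε) :=
  strictMono_nat_of_lt_succ fun k => by rw [stepTime_succ]; linarith [hε k]

/-- The index whose step contains the time `s`. -/
lemma exists_stepTime_le_lt (hsum : Tendsto (stepTime ε) atTop atTop) {s : ℝ} (hs : 0 ≤ s) :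
    ∃ m, stepTime ε m ≤ s ∧ s < stepTime ε m + ε m := by
  classical
  have hex : ∃ k, s < stepTime ε k := (hsum.eventually_gt_atTop s).exists
  have h1 : Nat.find hex ≠ 0 := fun h => by
    have := Nat.find_spec hex
    rw [h, stepTime, Finset.sum_range_zero] at this
    exact absurd this (not_lt.2 hs)
  obtain ⟨m, hm⟩ := Nat.exists_eq_succ_of_ne_zero h1
  refine ⟨m, not_lt.1 (Nat.find_min hex (by lia)), ?_⟩
  rw [← stepTime_succ, ← Nat.succ_eq_add_one, ← hm]
  exact Nat.find_spec hex

lemma stepTime_nonneg (hε : ∀ k, 0 < ε k) (n : ℕ) : 0 ≤ stepTime ε n :=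
  Finset.sum_nonneg fun k _ => (hε k).le

lemma IsLipschitzSemiflow.continuousOn (hΦ : IsLipschitzSemiflow Φ S L M) {t : ℝ} (ht : 0 ≤ t) :
    ContinuousOn (Φ t) S :=
  (LipschitzOnWith.of_dist_le_mul (K := ⟨Real.exp (L * t), (Real.exp_pos _).le⟩)
    fun x hx y hy => by
      rw [mul_comm]; exact hΦ.dist_space x hx y hy t ht).continuousOn

/-- The flow for a fixed time, started at an iterate, ends near each iterate whose time differs by
at most a step from that fixed time. -/
lemma Tracks.eventually_dist_le (h : Tracks Φ ε θ) (hΦ : IsLipschitzSemiflow Φ S L M)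
    (hε : ∀ k, 0 < ε k) (hε0 : Tendsto ε atTop (𝓝 0))
    (hS : ∀ k, θ (k + 1) ∈ S) {t δ : ℝ} (ht : 0 ≤ t) (hδ : 0 < δ) :
    ∀ᶠ n in atTop, ∀ m, n ≤ m → |stepTime ε m - stepTime ε n - t| ≤ ε n ⊔ ε m →
      dist (θ m) (Φ t (θ n)) ≤ δ := by
  have hεc : ∀ κ > 0, ∀ᶠ n in atTop, ∀ k, n ≤ k → ε k ≤ κ := fun κ hκ =>
    (eventually_atTop.1 (hε0.eventually_le_const hκ)).elim fun n hn => by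
      filter_upwards [eventually_ge_atTop n] with n' hn' k hk using hn k (hn'.trans hk)
  have hκ : 0 < δ / 2 / (M + 1) := by positivity
  filter_upwards [h (t + 1) (δ / 2) (by linarith) (by linarith), hεc _ hκ, hεc 1 one_pos,
    eventually_ge_atTop 1] with n h1 h2 h3 h4 m hnm hm
  have hn : θ n ∈ S := by
    obtain ⟨k, rfl⟩ : ∃ l, n = l + 1 := ⟨n - 1, by lia⟩
    exact hS k
  have h5 : stepTime ε m - stepTime ε n ≤ t + 1 := by
    have := (abs_le.1 (hm.trans (max_le (h3 n le_rfl) (h3 m hnm)))).2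
    linarith
  have h6 := hΦ.dist_time _ hn _ t (sub_nonneg.2 (stepTime_mono hε hnm)) ht
  have h7 : M * |stepTime ε m - stepTime ε n - t| ≤ δ / 2 := by
    calc _ ≤ (M + 1) * (δ / 2 / (M + 1)) := by
          gcongr
          · linarith
          · exact hm.trans (max_le (h2 n le_rfl) (h2 m hnm))
      _ = δ / 2 := by field_simp
  linarith [dist_triangle (θ m) (Φ (stepTime ε m - stepTime ε n) (θ n)) (Φ t (θ n)), h1 m hnm h5]

lemma mem_limitSet_iff {u : ℕ → Fin I → ℝ} {x : Fin I → ℝ} :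
    x ∈ limitSet u ↔ ∀ δ > 0, ∀ N, ∃ n, N ≤ n ∧ dist (u n) x < δ := by
  rw [limitSet, Set.mem_ofPred_eq, Metric.nhds_basis_ball.mapClusterPt_iff_frequently]
  simp only [Metric.mem_ball, frequently_atTop]

lemma mem_of_recursion_mem (hS : ∀ k, θ (k + 1) ∈ S) {n : ℕ} (hn : 1 ≤ n) : θ n ∈ S := by
  obtain ⟨k, rfl⟩ : ∃ l, n = l + 1 := ⟨n - 1, by lia⟩
  exact hS k

lemma limitSet_subset (hSc : IsClosed S) (hS : ∀ k, θ (k + 1) ∈ S) : limitSet θ ⊆ S :=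
  fun x hx => by
    rw [← hSc.closure_eq, Metric.mem_closure_iff]
    intro δ hδ
    obtain ⟨n, hn, hd⟩ := mem_limitSet_iff.1 hx δ hδ 1
    exact ⟨_, mem_of_recursion_mem hS hn, by rwa [dist_comm]⟩

lemma isClosed_limitSet (u : ℕ → Fin I → ℝ) : IsClosed (limitSet u) :=
  isClosed_setOfPred_clusterPt

lemma exists_mem_limitSet_of_frequently {K : Set (Fin I → ℝ)} (hK : IsCompact K)
    (h : ∃ᶠ k in atTop, θ k ∈ K) : ∃ x ∈ K, x ∈ limitSet θ :=
  hK.exists_mapClusterPt_of_frequently h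

theorem limitSet_nonempty (hSc : IsCompact S) (hS : ∀ k, θ (k + 1) ∈ S) :
    (limitSet θ).Nonempty := by
  have h : ∃ᶠ k in atTop, θ k ∈ S := Eventually.frequently (by
    filter_upwards [eventually_ge_atTop 1] with n hn using mem_of_recursion_mem hS hn)
  obtain ⟨x, -, hx⟩ := exists_mem_limitSet_of_frequently hSc h
  exact ⟨x, hx⟩

theorem isCompact_limitSet (hSc : IsCompact S) (hS : ∀ k, θ (k + 1) ∈ S) :
    IsCompact (limitSet θ) :=
  hSc.of_isClosed_subset (isClosed_limitSet θ) (limitSet_subset hSc.isClosed hS)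

theorem tendsto_infDist_limitSet (hSc : IsCompact S) (hS : ∀ k, θ (k + 1) ∈ S) :
    Tendsto (fun k => Metric.infDist (θ k) (limitSet θ)) atTop (𝓝 0) := by
  refine Metric.tendsto_atTop'.2 fun δ hδ => ?_
  by_contra! hcon
  have hcont : Continuous fun x => Metric.infDist x (limitSet θ) := Metric.continuous_infDist_pt _
  have hK : IsCompact (S ∩ {x | δ ≤ Metric.infDist x (limitSet θ)}) :=
    hSc.inter_right (isClosed_le continuous_const hcont)
  have hfreq : ∃ᶠ k in atTop, θ k ∈ S ∩ {x | δ ≤ Metric.infDist x (limitSet θ)} := by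
    refine frequently_atTop.2 fun N => ?_
    obtain ⟨n, hn, hd⟩ := hcon (N ⊔ 1)
    refine ⟨n, by lia, mem_of_recursion_mem hS (by lia), ?_⟩
    rwa [Real.dist_0_eq_abs, abs_of_nonneg Metric.infDist_nonneg] at hd
  obtain ⟨x, hx, hxL⟩ := exists_mem_limitSet_of_frequently hK hfreq
  have h0 := hx.2
  rw [Set.mem_ofPred_eq, Metric.infDist_zero_of_mem hxL] at h0
  linarith

/-- If iterates approach a limit point `x`, then those a time `t` later approach `Φ t x`, by tracking.
Conversely, the iterates a time `t` before those near `x` are themselves close to the limit set, so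
that `x` is in the closure of the compact image of the limit set. -/
theorem Tracks.image_limitSet (h : Tracks Φ ε θ) (hΦ : IsLipschitzSemiflow Φ S L M)
    (hε : ∀ k, 0 < ε k) (hε0 : Tendsto ε atTop (𝓝 0)) (hsum : Tendsto (stepTime ε) atTop atTop)
    (hSc : IsCompact S) (hS : ∀ k, θ (k + 1) ∈ S) {t : ℝ} (ht : 0 ≤ t) :
    Φ t '' limitSet θ = limitSet θ := by
  have hLS := limitSet_subset hSc.isClosed hS
  have hexp := Real.exp_pos (L * t)
  apply Set.Subset.antisymm
  · rintro _ ⟨x, hx, rfl⟩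
    refine mem_limitSet_iff.2 fun δ hδ N => ?_
    obtain ⟨n₀, hn₀⟩ := eventually_atTop.1
      (h.eventually_dist_le hΦ hε hε0 hS ht (half_pos hδ))
    obtain ⟨n, hn, hd⟩ := mem_limitSet_iff.1 hx (δ / 2 / Real.exp (L * t)) (by positivity)
      (n₀ ⊔ N ⊔ 1)
    obtain ⟨m, hm1, hm2⟩ := exists_stepTime_le_lt hsum
      (add_nonneg (stepTime_nonneg hε n) ht)
    have hnm : n ≤ m := by
      rw [← stepTime_succ] at hm2
      have := (stepTime_strictMono hε).lt_iff_lt.1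
        ((le_add_of_nonneg_right ht).trans_lt hm2)
      lia
    have h1 := hn₀ n (by lia) m hnm (le_max_of_le_right
      (abs_le.2 ⟨by linarith, by linarith [(hε m).le]⟩))
    have h2 := hΦ.dist_space _ (mem_of_recursion_mem hS (by lia : 1 ≤ n)) x (hLS hx) t ht
    have h3 : dist (θ n) x * Real.exp (L * t) < δ / 2 := by rwa [lt_div_iff₀ hexp] at hd
    exact ⟨m, by lia, by linarith [dist_triangle (θ m) (Φ t (θ n)) (Φ t x)]⟩
  · intro x hx
    have hcl : IsClosed (Φ t '' limitSet θ) :=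
      ((isCompact_limitSet hSc hS).image_of_continuousOn ((hΦ.continuousOn ht).mono hLS)).isClosed
    rw [← hcl.closure_eq, Metric.mem_closure_iff]
    intro δ hδ
    have hδ3 : 0 < δ / 3 := by positivity
    obtain ⟨n₁, hn₁⟩ := eventually_atTop.1 (h.eventually_dist_le hΦ hε hε0 hS ht hδ3)
    obtain ⟨n₂, hn₂⟩ := eventually_atTop.1 ((tendsto_infDist_limitSet hSc hS).eventually_lt_const
      (show 0 < δ / 3 / Real.exp (L * t) by positivity))
    obtain ⟨n₃, hn₃⟩ := eventually_atTop.1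
      (hsum.eventually_ge_atTop (stepTime ε (n₁ ⊔ n₂ ⊔ 1) + t))
    obtain ⟨n, hn, hd⟩ := mem_limitSet_iff.1 hx _ hδ3 n₃
    have h1 := hn₃ n hn
    obtain ⟨m, hm1, hm2⟩ := exists_stepTime_le_lt (s := stepTime ε n - t) hsum
      (by linarith [stepTime_nonneg hε (n₁ ⊔ n₂ ⊔ 1)])
    have hm3 : n₁ ⊔ n₂ ⊔ 1 ≤ m := by
      rw [← stepTime_succ] at hm2
      have := (stepTime_strictMono hε).lt_iff_lt.1
        (show stepTime ε (n₁ ⊔ n₂ ⊔ 1) < stepTime ε (m + 1) by linarith)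
      lia
    have hmn : m ≤ n := (stepTime_strictMono hε).le_iff_le.1 (by linarith)
    have h2 := hn₁ m (by lia) n hmn (le_max_of_le_left
      (abs_le.2 ⟨by linarith [(hε m).le], by linarith⟩))
    obtain ⟨w, hw, hwd⟩ := (Metric.infDist_lt_iff (limitSet_nonempty hSc hS)).1
      (hn₂ m (by lia))
    have h3 := hΦ.dist_space _ (mem_of_recursion_mem hS (by lia : 1 ≤ m)) w (hLS hw) t ht
    have h4 : dist (θ m) w * Real.exp (L * t) < δ / 3 := by rwa [lt_div_iff₀ hexp] at hwd
    refine ⟨_, ⟨w, hw, rfl⟩, ?_⟩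
    rw [dist_comm] at hd
    linarith [dist_triangle4 x (θ n) (Φ t (θ m)) (Φ t w)]

variable {U B : Set (Fin I → ℝ)}

lemma IsAsympStable.basin_subset (hU : IsAsympStable Φ S U B) : B ⊆ S := by
  obtain ⟨O, -, rfl⟩ := hU.basin_open
  exact Set.inter_subset_right

/-- An asymptotically stable set attracts the compact subsets of its basin uniformly: near each
point the trajectories have entered a Lyapunov neighbourhood by a common time. -/
lemma IsAsympStable.exists_uniform_time (hU : IsAsympStable Φ S U B)
    (hΦ : IsLipschitzSemiflow Φ S L M) {K : Set (Fin I → ℝ)} (hK : IsCompact K) (hKB : K ⊆ B)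
    {δ : ℝ} (hδ : 0 < δ) :
    ∃ T, 0 < T ∧ ∀ x ∈ K, ∀ t, T ≤ t → Metric.infDist (Φ t x) U ≤ δ := by
  obtain ⟨δ', hδ', hly⟩ := hU.lyapunov δ hδ
  have hKS : K ⊆ S := hKB.trans hU.basin_subset
  refine hK.induction_on (p := fun s => ∃ T, 0 < T ∧ ∀ x ∈ s ∩ K, ∀ t, T ≤ t →
    Metric.infDist (Φ t x) U ≤ δ) ⟨1, one_pos, by simp⟩ ?_ ?_ ?_ |>.imp fun T hT =>
      ⟨hT.1, fun x hx => hT.2 x ⟨hx, hx⟩⟩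
  · rintro s s' hs ⟨T, hT, h⟩
    exact ⟨T, hT, fun x hx => h x ⟨hs hx.1, hx.2⟩⟩
  · rintro s s' ⟨T, hT, h⟩ ⟨T', hT', h'⟩
    refine ⟨T ⊔ T', lt_max_of_lt_left hT, ?_⟩
    rintro x ⟨hx | hx, hxK⟩ t ht
    · exact h x ⟨hx, hxK⟩ t ((le_max_left _ _).trans ht)
    · exact h' x ⟨hx, hxK⟩ t ((le_max_right _ _).trans ht)
  · intro x hx
    obtain ⟨T, hT, hT0⟩ := (((hU.attracts x (hKB hx)).eventually_lt_const hδ').and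
      (eventually_gt_atTop 0)).exists
    have hcont : ContinuousWithinAt (fun y => Metric.infDist (Φ T y) U) K x :=
      (Metric.continuous_infDist_pt U).continuousAt.comp_continuousWithinAt
        (((hΦ.continuousOn hT0.le).mono hKS) x hx)
    refine ⟨{y | Metric.infDist (Φ T y) U < δ'}, hcont.eventually_lt_const hT, T, hT0, ?_⟩
    rintro y ⟨hy, hyK⟩ t ht
    have := hly (Φ T y) (hΦ.mem y (hKS hyK) T hT0.le) (le_of_lt hy) (t - T) (sub_nonneg.2 ht)
    rwa [← hΦ.add y (hKS hyK) T (t - T) hT0.le (sub_nonneg.2 ht), add_sub_cancel] at this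

/-- A sequence which tracks the flow and visits a compact part of the basin infinitely often comes
close to `U`. Once it is in a small Lyapunov neighbourhood of `U`, contained in a compact part of
the basin, it returns there after a fixed time, and stays near `U` in between. -/
theorem IsAsympStable.tendsto_infDist (hU : IsAsympStable Φ S U B) (h : Tracks Φ ε θ)
    (hΦ : IsLipschitzSemiflow Φ S L M)
    (hε : ∀ k, 0 < ε k) (hε0 : Tendsto ε atTop (𝓝 0)) (hsum : Tendsto (stepTime ε) atTop atTop)
    (hSc : IsCompact S) (hS : ∀ k, θ (k + 1) ∈ S) {K : Set (Fin I → ℝ)} (hK : IsCompact K)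
    (hKB : K ⊆ B) (hvisit : ∃ᶠ k in atTop, θ k ∈ K) :
    Tendsto (fun k => Metric.infDist (θ k) U) atTop (𝓝 0) := by
  -- a later index, reached after a time between `T` and `T + 1`
  have hnext : ∀ {T : ℝ}, 0 < T → ∀ᶠ n in atTop, ∃ m, n < m ∧
      T ≤ stepTime ε m - stepTime ε n ∧ stepTime ε m - stepTime ε n ≤ T + 1 := fun {T} hT => by
    obtain ⟨n₀, hn₀⟩ := eventually_atTop.1 (hε0.eventually_le_const one_pos)
    filter_upwards [eventually_ge_atTop n₀] with n hn
    obtain ⟨m, hm1, hm2⟩ := exists_stepTime_le_lt (s := stepTime ε n + (T + 1)) hsum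
      (by linarith [stepTime_nonneg hε n])
    have hnm : n ≤ m := by
      rw [← stepTime_succ] at hm2
      have := (stepTime_strictMono hε).lt_iff_lt.1
        (show stepTime ε n < stepTime ε (m + 1) by linarith)
      lia
    have h1 := hn₀ m (hn.trans hnm)
    exact ⟨m, (stepTime_strictMono hε).lt_iff_lt.1 (by linarith), by linarith, by linarith⟩
  -- the sequence comes near `U`
  have hnear : ∀ δ > 0, ∀ N, ∃ m, N ≤ m ∧ Metric.infDist (θ m) U ≤ δ := fun δ hδ N => by
    obtain ⟨T, hT, hunif⟩ := hU.exists_uniform_time hΦ hK hKB (half_pos hδ)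
    obtain ⟨n, hnK, htr, ⟨m, hm, hTm, hmT⟩, hnN⟩ := (hvisit.and_eventually
      ((h (T + 1) (δ / 2) (by linarith) (by linarith)).and
        ((hnext hT).and (eventually_ge_atTop N)))).exists
    refine ⟨m, by lia, ?_⟩
    have h1 := hunif _ hnK _ hTm
    have h2 := htr m hm.le hmT
    linarith [Metric.infDist_le_infDist_add_dist (s := U) (x := θ m)
      (y := Φ (stepTime ε m - stepTime ε n) (θ n))]
  obtain ⟨O, hO, hBO⟩ := hU.basin_open
  obtain ⟨η, hη, hηO⟩ := hU.isCompact.exists_thickening_subset_open hO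
    (hU.subset_basin.trans (hBO ▸ Set.inter_subset_left))
  set K' : Set (Fin I → ℝ) := S ∩ {x | Metric.infDist x U ≤ η / 2} with hK'
  have hK'c : IsCompact K' :=
    hSc.inter_right (isClosed_le (Metric.continuous_infDist_pt U) continuous_const)
  have hK'B : K' ⊆ B := fun x hx => by
    rw [hBO]
    refine ⟨hηO ((Metric.mem_thickening_iff_infDist_lt hU.nonempty).2 ?_), hx.1⟩
    have : Metric.infDist x U ≤ η / 2 := hx.2
    linarith
  refine Metric.tendsto_atTop'.2 fun δ hδ => ?_
  obtain ⟨δ', hδ', hly⟩ := hU.lyapunov (δ / 4) (by positivity)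
  set ρ := δ' ⊓ (η / 2) with hρ
  have hρ0 : 0 < ρ := lt_min hδ' (half_pos hη)
  obtain ⟨T, hT, hunif⟩ := hU.exists_uniform_time hΦ hK'c hK'B (half_pos hρ0)
  obtain ⟨n₀, hn₀⟩ := eventually_atTop.1
    (((h (T + 1) (δ / 4 ⊓ ρ / 2) (by linarith) (by positivity)).and (hnext hT)).and
      (eventually_ge_atTop 1))
  have hreturn : ∀ n, n₀ ≤ n → Metric.infDist (θ n) U ≤ ρ → ∃ m, n < m ∧
      Metric.infDist (θ m) U ≤ ρ ∧ ∀ k, n ≤ k → k ≤ m → Metric.infDist (θ k) U ≤ δ / 2 := by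
    intro n hn hρn
    obtain ⟨⟨htr, m, hm, hTm, hmT⟩, hn1⟩ := hn₀ n hn
    have hnS := mem_of_recursion_mem hS hn1
    have hnK : θ n ∈ K' := ⟨hnS, hρn.trans (min_le_right _ _)⟩
    have hclose : ∀ k, n ≤ k → k ≤ m → Metric.infDist (θ k) U ≤
        Metric.infDist (Φ (stepTime ε k - stepTime ε n) (θ n)) U + δ / 4 ⊓ ρ / 2 :=
      fun k hnk hkm => by
        have h1 := htr k hnk (by linarith [stepTime_mono hε hkm])
        linarith [Metric.infDist_le_infDist_add_dist (s := U) (x := θ k)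
          (y := Φ (stepTime ε k - stepTime ε n) (θ n))]
    refine ⟨m, hm, ?_, fun k hnk hkm => ?_⟩
    · linarith [hclose m hm.le le_rfl, hunif _ hnK _ hTm, min_le_right (δ / 4) (ρ / 2)]
    · have h1 := hly _ hnS (hρn.trans (min_le_left _ _)) _
        (sub_nonneg.2 (stepTime_mono hε hnk))
      linarith [hclose k hnk hkm, min_le_left (δ / 4) (ρ / 2)]
  obtain ⟨n₁, hn₁, hgood⟩ := hnear ρ hρ0 n₀
  refine ⟨n₁, fun k hk => ?_⟩
  -- the last index up to `k` at which the sequence is in the neighbourhood of radius `ρ`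
  classical
  let A := (Finset.Icc n₁ k).filter fun j => Metric.infDist (θ j) U ≤ ρ
  have hA : A.Nonempty := ⟨n₁, by simp [A, hgood, le_of_lt hk]⟩
  have hjA := A.max'_mem hA
  set j := A.max' hA with hj
  simp only [A, Finset.mem_filter, Finset.mem_Icc] at hjA
  obtain ⟨m, hjm, hm, hbd⟩ := hreturn j (by lia) hjA.2
  have hkm : k ≤ m := by
    by_contra! hlt
    have := A.le_max' m (by simp only [A, Finset.mem_filter, Finset.mem_Icc]; exact ⟨by lia, hm⟩)
    lia
  have := hbd k hjA.1.2 hkm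
  rw [Real.dist_0_eq_abs, abs_of_nonneg Metric.infDist_nonneg]
  linarith

end

/-! ### Exponential decay for Hurwitz matrices -/

section

/-- Square matrices as continuous linear maps of `𝕜 ^ I` with the sup norm. -/
noncomputable def matrixToCLM (𝕜 : Type*) [NontriviallyNormedField 𝕜] [CompleteSpace 𝕜] (I : ℕ) :
    Matrix (Fin I) (Fin I) 𝕜 ≃ₐ[𝕜] ((Fin I → 𝕜) →L[𝕜] (Fin I → 𝕜)) :=
  Matrix.toLinAlgEquiv'.trans (Module.End.toContinuousLinearMap _)

lemma matrixToCLM_apply {𝕜 : Type*} [NontriviallyNormedField 𝕜] [CompleteSpace 𝕜] {I : ℕ}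
    (A : Matrix (Fin I) (Fin I) 𝕜) (v : Fin I → 𝕜) : matrixToCLM 𝕜 I A v = A.mulVec v := rfl

variable {I : ℕ}

lemma norm_matrixToCLM_le (A : Matrix (Fin I) (Fin I) ℝ) :
    ‖matrixToCLM ℝ I A‖ ≤ ‖matrixToCLM ℂ I (A.map (algebraMap ℝ ℂ))‖ := by
  have hnorm : ∀ v : Fin I → ℝ, ‖fun i => (algebraMap ℝ ℂ) (v i)‖ = ‖v‖ := fun v => by
    refine le_antisymm ((pi_norm_le_iff_of_nonneg (norm_nonneg _)).2 fun i => ?_)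
      ((pi_norm_le_iff_of_nonneg (norm_nonneg _)).2 fun i => ?_)
    · rw [norm_algebraMap']; exact norm_le_pi_norm v i
    · rw [← norm_algebraMap' ℂ (v i)]
      exact norm_le_pi_norm (fun i => (algebraMap ℝ ℂ) (v i)) i
  refine ContinuousLinearMap.opNorm_le_bound _ (norm_nonneg _) fun v => ?_
  rw [← hnorm v, ← hnorm]
  refine le_trans (le_of_eq ?_) (ContinuousLinearMap.le_opNorm _ _)
  congr 1
  ext i
  exact (algebraMap ℝ ℂ).map_mulVec A v i

/-- For a Hurwitz matrix `A` and a small `h > 0` the spectrum of `1 + h A` lies in a disc of radius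
less than `1`, as `|1 + h z| ^ 2 = 1 + 2 h Re z + h ^ 2 |z| ^ 2`. -/
lemma IsHurwitz.exists_spectralRadius_lt {A : Matrix (Fin I) (Fin I) ℝ} (hA : IsHurwitz A) :
    ∃ h : ℝ, 0 < h ∧
      spectralRadius ℂ (matrixToCLM ℂ I ((1 + h • A).map (algebraMap ℝ ℂ))) < 1 := by
  set Ac := A.map (algebraMap ℝ ℂ) with hAc
  have hspec : ∀ B : Matrix (Fin I) (Fin I) ℂ, spectrum ℂ (matrixToCLM ℂ I B) = spectrum ℂ B :=
    fun B => AlgEquiv.spectrum_eq _ _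
  have hcomp : IsCompact (spectrum ℂ Ac) := hspec Ac ▸ spectrum.isCompact (matrixToCLM ℂ I Ac)
  obtain ⟨c, hc, hre⟩ := hcomp.exists_forall_le' (f := fun z : ℂ => -z.re) (a := 0)
    (Complex.continuous_re.neg.continuousOn) fun z hz => neg_pos.2 (hA z hz)
  obtain ⟨R, hR⟩ := hcomp.isBounded.exists_norm_le
  set h : ℝ := c / (R ^ 2 + 1) with hh
  have hR1 : 0 < R ^ 2 + 1 := by positivity
  have hpos : 0 < h := by positivity
  have hcR : h * (R ^ 2 + 1) = c := div_mul_cancel₀ _ hR1.ne'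
  refine ⟨h, hpos, ?_⟩
  set q : ℝ := 1 - h * c with hq
  have hle : ∀ w ∈ spectrum ℂ ((1 + h • A).map (algebraMap ℝ ℂ)), ‖w‖ ≤ Real.sqrt q := by
    intro w hw
    have hmat : (1 + h • A).map (algebraMap ℝ ℂ) =
        algebraMap ℂ _ 1 + (Units.mk0 (h : ℂ) (by exact_mod_cast hpos.ne')) • Ac := by
      ext i j
      simp [hAc, Matrix.one_apply, Units.smul_def, apply_ite]
    rw [hmat, ← spectrum.singleton_add_eq, spectrum.unit_smul_eq_smul] at hw
    obtain ⟨_, rfl, _, ⟨z, hz, rfl⟩, rfl⟩ := hw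
    refine Real.le_sqrt_of_sq_le ?_
    have h1 := hre z hz
    have h2 : ‖z‖ ^ 2 ≤ R ^ 2 := by gcongr; exact hR z hz
    rw [Complex.sq_norm, Complex.normSq_apply] at h2
    simp only [Units.val_mk0, smul_eq_mul]
    rw [Complex.sq_norm, Complex.normSq_apply]
    simp only [Complex.add_re, Complex.one_re, Complex.mul_re, Complex.ofReal_re,
      Complex.ofReal_im, zero_mul, sub_zero, Complex.add_im, Complex.one_im, Complex.mul_im,
      add_zero, zero_add]
    have h3 : h * (h * (z.re * z.re + z.im * z.im)) ≤ h * (h * R ^ 2) := by gcongr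
    have h4 : h * (h * R ^ 2) ≤ h * c := by gcongr; nlinarith
    have h5 : h * c ≤ h * -z.re := by gcongr
    linarith
  have hq1 : Real.sqrt q < 1 := by
    rw [Real.sqrt_lt' one_pos]
    have := mul_pos hpos hc
    linarith
  calc spectralRadius ℂ (matrixToCLM ℂ I ((1 + h • A).map (algebraMap ℝ ℂ)))
      ≤ ENNReal.ofReal (Real.sqrt q) := by
        refine iSup₂_le fun w hw => ?_
        rw [hspec] at hw
        rw [← ENNReal.ofReal_coe_nnreal]
        exact ENNReal.ofReal_le_ofReal (hle w hw)
    _ < 1 := by rwa [ENNReal.ofReal_lt_one]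

lemma exists_norm_pow_le_of_spectralRadius_lt_one {A : Type*} [NormedRing A] [NormedAlgebra ℂ A]
    [CompleteSpace A] {a : A} (ha : spectralRadius ℂ a < 1) :
    ∃ r K : ℝ, 0 < r ∧ r < 1 ∧ 0 ≤ K ∧ ∀ n : ℕ, ‖a ^ n‖ ≤ K * r ^ n := by
  obtain ⟨r, har, hr1⟩ := ENNReal.lt_iff_exists_nnreal_btwn.1 ha
  have hr0 : 0 < r := by
    by_contra! h0
    have : r = 0 := le_antisymm h0 bot_le
    simp [this] at har
  have hr1' : (r : ℝ) < 1 := by exact_mod_cast hr1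
  obtain ⟨n₀, hn₀⟩ := eventually_atTop.1
    ((spectrum.pow_nnnorm_pow_one_div_tendsto_nhds_spectralRadius a).eventually_lt_const har)
  have hlarge : ∀ n, n₀ ⊔ 1 ≤ n → ‖a ^ n‖ ≤ (r : ℝ) ^ n := fun n hn => by
    have hn1 : (0 : ℝ) < n := by exact_mod_cast (by lia : 0 < n)
    have h1 := hn₀ n (by lia)
    rw [one_div, ENNReal.rpow_inv_lt_iff hn1, ENNReal.rpow_natCast] at h1
    exact_mod_cast h1.le
  refine ⟨r, 1 + ∑ k ∈ Finset.range (n₀ ⊔ 1), ‖a ^ k‖ / (r : ℝ) ^ k, hr0, hr1', by positivity,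
    fun n => ?_⟩
  have hrn : (0 : ℝ) < (r : ℝ) ^ n := by positivity
  by_cases hn : n₀ ⊔ 1 ≤ n
  · refine (hlarge n hn).trans (le_mul_of_one_le_left hrn.le ?_)
    have : 0 ≤ ∑ k ∈ Finset.range (n₀ ⊔ 1), ‖a ^ k‖ / (r : ℝ) ^ k := by positivity
    linarith
  · rw [← div_le_iff₀ hrn]
    have := Finset.single_le_sum (f := fun k => ‖a ^ k‖ / (r : ℝ) ^ k) (fun k _ => by positivity)
      (Finset.mem_range.2 (not_le.1 hn))
    linarith

lemma norm_exp_smul_le {A : Type*} [NormedRing A] [NormedAlgebra ℝ A] [CompleteSpace A] {a : A}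
    {r K : ℝ} (ha : ∀ n : ℕ, ‖a ^ n‖ ≤ K * r ^ n) {s : ℝ} (hs : 0 ≤ s) :
    ‖NormedSpace.exp (s • a)‖ ≤ K * Real.exp (r * s) := by
  rw [NormedSpace.exp_eq_tsum ℝ]
  refine tsum_of_norm_bounded (g := fun n => K * ((r * s) ^ n / n.factorial)) ?_ fun n => ?_
  · rw [Real.exp_eq_exp_ℝ]
    exact (NormedSpace.expSeries_div_hasSum_exp (r * s)).mul_left K
  · rw [norm_smul, smul_pow, norm_smul, norm_inv, norm_pow, Real.norm_of_nonneg hs]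
    simp only [Real.norm_natCast]
    calc ((n.factorial : ℝ))⁻¹ * (s ^ n * ‖a ^ n‖)
        ≤ ((n.factorial : ℝ))⁻¹ * (s ^ n * (K * r ^ n)) := by gcongr; exact ha n
      _ = _ := by rw [mul_pow]; ring

/-- The solutions of `w' = A w` for a Hurwitz matrix `A` decay exponentially. With `P = 1 + h A` of
spectral radius less than `1` they are `exp (-t / h) exp ((t / h) P) v`, and the powers of `P` decay
geometrically by Gelfand's formula. -/
theorem IsHurwitz.exists_exponential_decay {A : Matrix (Fin I) (Fin I) ℝ} (hA : IsHurwitz A) :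
    ∃ K c : ℝ, 0 ≤ K ∧ 0 < c ∧ ∀ v : Fin I → ℝ, ∃ w : ℝ → Fin I → ℝ, w 0 = v ∧
      (∀ t, HasDerivAt w (A.mulVec (w t)) t) ∧
      ∀ t, 0 ≤ t → ‖w t‖ ≤ K * Real.exp (-(c * t)) * ‖v‖ := by
  obtain ⟨h, hh, hrad⟩ := hA.exists_spectralRadius_lt
  obtain ⟨r, K, -, hr1, hK, hpow⟩ := exists_norm_pow_le_of_spectralRadius_lt_one hrad
  set P := matrixToCLM ℝ I (1 + h • A) with hP
  have hPpow : ∀ n : ℕ, ‖P ^ n‖ ≤ K * r ^ n := fun n => by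
    refine le_trans ?_ (hpow n)
    rw [hP, ← map_pow, ← map_pow]
    refine (norm_matrixToCLM_le _).trans (le_of_eq ?_)
    congr 2
    exact map_pow (algebraMap ℝ ℂ).mapMatrix (1 + h • A) n
  refine ⟨K, (1 - r) / h, hK, div_pos (sub_pos.2 hr1) hh, fun v => ?_⟩
  set E : ℝ → (Fin I → ℝ) →L[ℝ] (Fin I → ℝ) := fun t => NormedSpace.exp ((t / h) • P) with hE
  refine ⟨fun t => Real.exp (-(t / h)) • E t v, by simp [hE], fun t => ?_, fun t ht => ?_⟩
  · have h1 : HasDerivAt (fun t : ℝ => t / h) (1 / h) t := (hasDerivAt_id t).div_const h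
    have h2 : HasDerivAt E ((1 / h) • (P * E t)) t :=
      HasDerivAt.scomp (g₁ := fun u : ℝ => NormedSpace.exp (u • P)) t
        (hasDerivAt_exp_smul_const' (𝕂 := ℝ) P (t / h)) h1
    have h3 : HasDerivAt (fun t => E t v) (((1 / h) • (P * E t)) v) t :=
      ((ContinuousLinearMap.apply ℝ (Fin I → ℝ) v).hasFDerivAt.comp_hasDerivAt t h2)
    have h4 : HasDerivAt (fun t => Real.exp (-(t / h))) (Real.exp (-(t / h)) * -(1 / h)) t :=
      h1.neg.exp
    refine (h4.smul h3).congr_deriv ?_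
    have h5 : P (E t v) = E t v + h • A.mulVec (E t v) := by
      rw [hP, matrixToCLM_apply, Matrix.add_mulVec, Matrix.one_mulVec, Matrix.smul_mulVec]
    rw [smul_apply, mul_apply_eq_comp, h5, Matrix.mulVec_smul]
    ext i
    simp only [Pi.add_apply, Pi.smul_apply, smul_eq_mul]
    field_simp
    ring
  · rw [norm_smul, Real.norm_of_nonneg (Real.exp_pos _).le]
    have h1 := norm_exp_smul_le hPpow (div_nonneg ht hh.le)
    calc Real.exp (-(t / h)) * ‖E t v‖
        ≤ Real.exp (-(t / h)) * (K * Real.exp (r * (t / h)) * ‖v‖) := by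
          gcongr
          exact ((E t).le_opNorm v).trans (by gcongr)
      _ = K * (Real.exp (-(t / h)) * Real.exp (r * (t / h))) * ‖v‖ := by ring
      _ = _ := by
          rw [← Real.exp_add]
          congr 3
          ring

end

/-! ### The equilibrium as an asymptotically stable point -/

section

variable {I : ℕ}

/-- A point of `S` near which the semiflow is stable and attracted to the point is asymptotically
stable; its basin is open in `S` by continuity of the flow in the initial value. -/
theorem isAsympStable_singleton {Φ : ℝ → (Fin I → ℝ) → Fin I → ℝ} {S : Set (Fin I → ℝ)}
    {L M : NNReal} (hΦ : IsLipschitzSemiflow Φ S L M) {p : Fin I → ℝ} (hp : p ∈ S) {ρ K : ℝ}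
    (hρ : 0 < ρ) (hK : 0 ≤ K)
    (hstab : ∀ x ∈ S, dist x p ≤ ρ → ∀ t, 0 ≤ t → dist (Φ t x) p ≤ K * dist x p)
    (hattr : ∀ x ∈ S, dist x p ≤ ρ → Tendsto (fun t => Φ t x) atTop (𝓝 p)) :
    IsAsympStable Φ S {p} {x | x ∈ S ∧ Tendsto (fun t => Φ t x) atTop (𝓝 p)} := by
  have hfix : ∀ t, 0 ≤ t → Φ t p = p := fun t ht => by
    have := hstab p hp (by simpa using hρ.le) t ht
    rw [dist_self, mul_zero] at this
    exact dist_le_zero.1 this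
  have hshift : ∀ x ∈ S, ∀ T, 0 ≤ T → Tendsto (fun t => Φ t (Φ T x)) atTop (𝓝 p) →
      Tendsto (fun t => Φ t x) atTop (𝓝 p) := fun x hx T hT h => by
    refine (h.comp (tendsto_atTop_add_const_right _ (-T) tendsto_id)).congr' ?_
    filter_upwards [eventually_ge_atTop T] with t ht
    simp only [Function.comp, id]
    rw [← hΦ.add x hx T _ hT (by linarith)]
    congr 1
    ring
  refine ⟨⟨p, rfl⟩, isCompact_singleton, ?_, ?_, ?_, ?_, ?_, ?_⟩
  · rintro _ rfl
    exact ⟨hp, hattr _ hp (by simpa using hρ.le)⟩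
  · refine ⟨interior ({x | x ∈ S ∧ Tendsto (fun t => Φ t x) atTop (𝓝 p)} ∪ Sᶜ), isOpen_interior,
      Set.Subset.antisymm (fun x hx => ⟨?_, hx.1⟩) fun x hx =>
        (interior_subset hx.1).resolve_right fun h => h hx.2⟩
    obtain ⟨T, hT, hT0⟩ := ((Metric.tendsto_nhds.1 hx.2 (ρ / 2) (half_pos hρ)).and
      (eventually_ge_atTop 0)).exists
    have hexp := Real.exp_pos (L * T)
    refine mem_interior_iff_mem_nhds.2 (Metric.mem_nhds_iff.2
      ⟨ρ / 2 / Real.exp (L * T), by positivity, fun x' hx' => ?_⟩)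
    by_cases hS : x' ∈ S
    · refine Or.inl ⟨hS, hshift x' hS T hT0 (hattr _ (hΦ.mem x' hS T hT0) ?_)⟩
      have h1 := hΦ.dist_space x' hS x hx.1 T hT0
      have h2 : dist x' x * Real.exp (L * T) < ρ / 2 := by
        rwa [Metric.mem_ball, lt_div_iff₀ hexp] at hx'
      linarith [dist_triangle (Φ T x') (Φ T x) p]
    · exact Or.inr hS
  · rintro _ rfl t ht
    exact hfix t ht
  · rintro x ⟨hx, hlim⟩ t ht
    refine ⟨hΦ.mem x hx t ht, (hlim.comp (tendsto_atTop_add_const_left _ t tendsto_id)).congr' ?_⟩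
    filter_upwards [eventually_ge_atTop 0] with s hs
    exact hΦ.add x hx t s ht hs
  · intro δ₁ hδ₁
    refine ⟨ρ ⊓ δ₁ / (K + 1), by positivity, fun x hx hd t ht => ?_⟩
    rw [Metric.infDist_singleton] at hd ⊢
    have h1 := hstab x hx (hd.trans (min_le_left _ _)) t ht
    have h2 : dist x p * (K + 1) ≤ δ₁ :=
      (le_div_iff₀ (by positivity)).1 (hd.trans (min_le_right _ _))
    have : 0 ≤ dist x p := dist_nonneg
    linarith
  · rintro x ⟨-, hlim⟩
    simp_rw [Metric.infDist_singleton]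
    exact tendsto_iff_dist_tendsto_zero.1 hlim

variable {C A : Matrix (Fin I) (Fin I) ℝ} {b lo hi : Fin I → ℝ}
  {Φ : ℝ → (Fin I → ℝ) → Fin I → ℝ}

lemma perf_eq (hA : IsUnit A.det) (b x : Fin I → ℝ) :
    perf A b x = A.mulVec (x - equilibrium A b) := by
  rw [perf, equilibrium, sub_neg_eq_add, Matrix.mulVec_add, Matrix.mulVec_mulVec,
    Matrix.mul_nonsing_inv _ hA, Matrix.one_mulVec]

lemma mulVec_perf (C : Matrix (Fin I) (Fin I) ℝ) (hA : IsUnit A.det) (b x : Fin I → ℝ) :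
    C.mulVec (perf A b x) = coordField C A b x := by
  rw [perf_eq hA, coordField, Matrix.mulVec_mulVec]

lemma lipschitzWith_coordField (C A : Matrix (Fin I) (Fin I) ℝ) (b : Fin I → ℝ) :
    ∃ L, LipschitzWith L (coordField C A b) :=
  ⟨_, (matrixToCLM ℝ I (C * A)).lipschitz.comp
    (LipschitzWith.id.sub (LipschitzWith.const (equilibrium A b)))⟩

/-- For Hurwitz `C A` the solutions of the coordinated equation converge exponentially to the
equilibrium. -/
lemma exists_integralCurve_of_isHurwitz (h : IsHurwitz (C * A)) (b : Fin I → ℝ) :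
    ∃ K c : ℝ, 0 ≤ K ∧ 0 < c ∧ ∀ x : Fin I → ℝ, ∃ y : ℝ → Fin I → ℝ, y 0 = x ∧
      (∀ s, IsIntegralCurveOn y (fun _ => coordField C A b) s) ∧
      ∀ t, 0 ≤ t → dist (y t) (equilibrium A b) ≤
        K * Real.exp (-(c * t)) * dist x (equilibrium A b) := by
  obtain ⟨K, c, hK, hc, hw⟩ := h.exists_exponential_decay
  refine ⟨K, c, hK, hc, fun x => ?_⟩
  obtain ⟨w, hw0, hwd, hwn⟩ := hw (x - equilibrium A b)
  refine ⟨fun t => w t + equilibrium A b, by simp [hw0], fun s t _ => ?_, fun t ht => ?_⟩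
  · refine ((hwd t).add_const _).hasDerivWithinAt.congr_deriv ?_
    simp only [coordField, add_sub_cancel_right]
  · rw [dist_eq_norm, dist_eq_norm, add_sub_cancel_right]
    exact hwn t ht

lemma tendsto_of_dist_le_exp {y : ℝ → Fin I → ℝ} {p : Fin I → ℝ} {K c d : ℝ} (hc : 0 < c)
    (h : ∀ t, 0 ≤ t → dist (y t) p ≤ K * Real.exp (-(c * t)) * d) :
    Tendsto y atTop (𝓝 p) := by
  refine tendsto_iff_dist_tendsto_zero.2 (squeeze_zero' (Eventually.of_forall fun _ => dist_nonneg)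
    (by filter_upwards [eventually_ge_atTop 0] with t ht using h t ht) ?_)
  have : Tendsto (fun t => Real.exp (-(c * t))) atTop (𝓝 0) :=
    Real.tendsto_exp_neg_atTop_nhds_zero.comp (tendsto_id.const_mul_atTop hc)
  simpa using (this.const_mul K).mul_const d

lemma mul_exp_mul_le {K c d t : ℝ} (hK : 0 ≤ K) (hc : 0 < c) (hd : 0 ≤ d) (ht : 0 ≤ t) :
    K * Real.exp (-(c * t)) * d ≤ K * d := by
  have : Real.exp (-(c * t)) ≤ 1 := Real.exp_le_one_iff.2 (by have := mul_nonneg hc.le ht; linarith)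
  gcongr
  exact mul_le_of_le_one_right hK this

/-- Near an interior equilibrium the solutions of the coordinated equation do not reach the
boundary of the box, so they are the trajectories of the projected equation. -/
theorem isAsympStable_equilibrium_of_mem_interior
    (hΦ : IsProjFlow (coordField C A b) lo hi Φ) (hlh : ∀ i, lo i < hi i)
    (h : IsHurwitz (C * A)) (hint : equilibrium A b ∈ interior (Set.Icc lo hi)) :
    IsAsympStable Φ (Set.Icc lo hi) {equilibrium A b}
      {x | x ∈ Set.Icc lo hi ∧ Tendsto (fun t => Φ t x) atTop (𝓝 (equilibrium A b))} := by
  obtain ⟨L, hL⟩ := lipschitzWith_coordField C A b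
  obtain ⟨M, hM⟩ := exists_norm_le_of_continuous (lo := lo) (hi := hi) hL.continuous
  obtain ⟨K, c, hK, hc, hy⟩ := exists_integralCurve_of_isHurwitz h b
  obtain ⟨R, hR, hRS⟩ := Metric.mem_nhds_iff.1 (mem_interior_iff_mem_nhds.1 hint)
  have hloc : ∀ x, dist x (equilibrium A b) ≤ R / (K + 1) / 2 → ∀ t, 0 ≤ t →
      dist (Φ t x) (equilibrium A b) ≤ K * Real.exp (-(c * t)) * dist x (equilibrium A b) := by
    intro x hx t ht
    obtain ⟨y, rfl, hyc, hyd⟩ := hy x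
    have hstay : ∀ s, 0 ≤ s → y s ∈ Set.Icc lo hi := fun s hs => by
      refine hRS (Metric.mem_ball.2 ((hyd s hs).trans_lt ?_))
      calc _ ≤ K * dist (y 0) (equilibrium A b) := mul_exp_mul_le hK hc dist_nonneg hs
        _ ≤ (K + 1) * (R / (K + 1) / 2) := by gcongr; linarith
        _ = R / 2 := by field_simp
        _ < R := half_lt_self hR
    rw [hΦ.eq_of_isIntegralCurveOn hL ht (hyc _) (fun s hs => hstay s hs.1) t ⟨ht, le_rfl⟩]
    exact hyd t ht
  exact isAsympStable_singleton (hΦ.isLipschitzSemiflow hlh hL hM) (interior_subset hint)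
    (ρ := R / (K + 1) / 2) (by positivity) hK
    (fun x _ hx t ht => (hloc x hx t ht).trans (mul_exp_mul_le hK hc dist_nonneg ht))
    (fun x _ hx => tendsto_of_dist_le_exp hc (hloc x hx))

/-- If the coordinated equation leaves the box invariant, then the whole box is in the basin of its
equilibrium. -/
theorem isAsympStable_equilibrium_of_invariant
    (hΦ : IsProjFlow (coordField C A b) lo hi Φ) (hlh : ∀ i, lo i < hi i)
    (h : IsHurwitz (C * A))
    (hinv : ∀ y : ℝ → Fin I → ℝ, IsIntegralCurveOn y (fun _ => coordField C A b) (Set.Ici 0) →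
      y 0 ∈ Set.Icc lo hi → ∀ t, 0 ≤ t → y t ∈ Set.Icc lo hi) :
    IsAsympStable Φ (Set.Icc lo hi) {equilibrium A b} (Set.Icc lo hi) := by
  obtain ⟨L, hL⟩ := lipschitzWith_coordField C A b
  obtain ⟨M, hM⟩ := exists_norm_le_of_continuous (lo := lo) (hi := hi) hL.continuous
  obtain ⟨K, c, hK, hc, hy⟩ := exists_integralCurve_of_isHurwitz h b
  have hflow := hΦ.isLipschitzSemiflow hlh hL hM
  have hexp : ∀ x ∈ Set.Icc lo hi, ∀ t, 0 ≤ t →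
      dist (Φ t x) (equilibrium A b) ≤ K * Real.exp (-(c * t)) * dist x (equilibrium A b) := by
    intro x hx t ht
    obtain ⟨y, rfl, hyc, hyd⟩ := hy x
    rw [hΦ.eq_of_isIntegralCurveOn hL ht (hyc _) (fun s hs => hinv y (hyc _) hx s hs.1)
      t ⟨ht, le_rfl⟩]
    exact hyd t ht
  have hlo : lo ∈ Set.Icc lo hi := ⟨le_rfl, fun i => (hlh i).le⟩
  have hmem : equilibrium A b ∈ Set.Icc lo hi :=
    isClosed_Icc.mem_of_tendsto (tendsto_of_dist_le_exp hc (hexp lo hlo)) (by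
      filter_upwards [eventually_ge_atTop 0] with t ht using hflow.mem lo hlo t ht)
  have hbasin : {x | x ∈ Set.Icc lo hi ∧ Tendsto (fun t => Φ t x) atTop (𝓝 (equilibrium A b))} =
      Set.Icc lo hi :=
    Set.Subset.antisymm (fun x hx => hx.1) fun x hx => ⟨hx, tendsto_of_dist_le_exp hc (hexp x hx)⟩
  have := isAsympStable_singleton hflow hmem one_pos hK
    (fun x hx _ t ht => (hexp x hx t ht).trans (mul_exp_mul_le hK hc dist_nonneg ht))
    (fun x hx _ => tendsto_of_dist_le_exp hc (hexp x hx))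
  rwa [hbasin] at this

/-! ### The coordinated scheme -/

variable {Ω : Type*}

lemma coordSA_succ (hA : IsUnit A.det) (ε : ℕ → ℝ) (N : ℕ → Ω → Fin I → ℝ)
    (θ₀ : Ω → Fin I → ℝ) (k : ℕ) (ω : Ω) :
    coordSA C A b lo hi ε N θ₀ (k + 1) ω = boxProj lo hi (coordSA C A b lo hi ε N θ₀ k ω +
      ε k • (coordField C A b (coordSA C A b lo hi ε N θ₀ k ω) + C.mulVec (N k ω))) := by
  rw [← mulVec_perf C hA, ← Matrix.mulVec_add]
  rfl

/-- The coordinated noise is the image of the noise under a linear map, so it is again an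
`L²`-bounded martingale difference sequence. -/
lemma ae_exists_tendsto_sum_mulVec [MeasurableSpace Ω] {μ : Measure Ω} [IsProbabilityMeasure μ]
    (C : Matrix (Fin I) (Fin I) ℝ) {N : ℕ → Ω → Fin I → ℝ} (hN : IsMartingaleDifference μ N)
    {ε : ℕ → ℝ} (hε : Summable fun k => ε k ^ 2) {K : NNReal} (hK : ∀ k, eLpNorm (N k) 2 μ ≤ K) :
    ∀ᵐ ω ∂μ, ∀ i, ∃ c,
      Tendsto (fun n => ∑ k ∈ Finset.range n, ε k * C.mulVec (N k ω) i) atTop (𝓝 c) := by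
  rw [ae_all_iff]
  intro i
  set T : (Fin I → ℝ) →L[ℝ] ℝ := (ContinuousLinearMap.proj i).comp (matrixToCLM ℝ I C) with hT
  refine (hN.clm_comp T).ae_exists_tendsto_sum hε (K := ‖T‖₊ * K) fun k => ?_
  refine (eLpNorm_le_nnreal_smul_eLpNorm_of_ae_le_mul
    (Eventually.of_forall fun ω => T.le_opNNNorm (N k ω)) 2).trans ?_
  rw [ENNReal.coe_mul, ENNReal.smul_def, smul_eq_mul]
  gcongr
  exact hK k

end

end CoordSA

theorem mainTheorem5 {Ω : Type*} [MeasurableSpace Ω] (μ : Measure Ω) [IsProbabilityMeasure μ]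
    {I : ℕ} (C A : Matrix (Fin I) (Fin I) ℝ) (hA : IsUnit A.det) (b : Fin I → ℝ)
    (N : ℕ → Ω → Fin I → ℝ) (hN : CoordSA.IsMartingaleDifference μ N) :
    -- the coordinated noise is a martingale difference, coordinate by coordinate
    -- and as a vector
    (∀ i, CoordSA.IsMartingaleDifference μ (fun k ω => ∑ j, C i j * N k ω j)) ∧
    CoordSA.IsMartingaleDifference μ (fun k ω i => ∑ j, C i j * N k ω j) ∧
    -- behaviour of the projected coordinated scheme
    ∀ (lo hi : Fin I → ℝ), (∀ i, lo i < hi i) →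
    ∀ ε : ℕ → ℝ, (∀ k, 0 < ε k) → Tendsto (CoordSA.stepTime ε) atTop atTop →
      Summable (fun k => ε k ^ 2) →
    (∃ K : NNReal, ∀ k, eLpNorm (N k) 2 μ ≤ K) →
    ∀ (θ₀ : Ω → Fin I → ℝ) (θ : ℕ → Ω → Fin I → ℝ),
      θ = CoordSA.coordSA C A b lo hi ε N θ₀ →
    -- the iterates stay in the box, and the projected coordinated ODE has a flow
    (∀ k ω, θ (k + 1) ω ∈ Set.Icc lo hi) ∧
    ∃ Φ : ℝ → (Fin I → ℝ) → Fin I → ℝ,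
      CoordSA.IsProjFlow (CoordSA.coordField C A b) lo hi Φ ∧
      -- it is the flow of the coordinated ODE as long as the latter stays in the box
      (∀ (T : ℝ) (y : ℝ → Fin I → ℝ), 0 ≤ T →
        IsIntegralCurveOn y (fun _ => CoordSA.coordField C A b) (Set.Icc 0 T) →
        (∀ t ∈ Set.Icc 0 T, y t ∈ Set.Icc lo hi) → ∀ t ∈ Set.Icc 0 T, Φ t (y 0) = y t) ∧
      -- the iterates track this flow on every bounded time window
      (∀ᵐ ω ∂μ, ∀ T δ : ℝ, 0 < T → 0 < δ → ∀ᶠ n in atTop, ∀ m, n ≤ m →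
        CoordSA.stepTime ε m - CoordSA.stepTime ε n ≤ T →
        dist (θ m ω) (Φ (CoordSA.stepTime ε m - CoordSA.stepTime ε n) (θ n ω)) ≤ δ) ∧
      -- they converge to their limit set, which is compact and invariant under the flow
      (∀ᵐ ω ∂μ, (CoordSA.limitSet (fun k => θ k ω)).Nonempty ∧
        IsCompact (CoordSA.limitSet (fun k => θ k ω)) ∧
        (∀ t, 0 ≤ t →
          Φ t '' CoordSA.limitSet (fun k => θ k ω) = CoordSA.limitSet (fun k => θ k ω)) ∧
        Tendsto (fun k => Metric.infDist (θ k ω) (CoordSA.limitSet (fun k => θ k ω)))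
          atTop (𝓝 0)) ∧
      -- they converge to each asymptotically stable set, provided that they visit infinitely
      -- often a compact part of its basin (automatic if the whole box is in the basin)
      (∀ᵐ ω ∂μ, ∀ U B : Set (Fin I → ℝ), CoordSA.IsAsympStable Φ (Set.Icc lo hi) U B →
        ∀ K : Set (Fin I → ℝ), IsCompact K → K ⊆ B → (∃ᶠ k in atTop, θ k ω ∈ K) →
        Tendsto (fun k => Metric.infDist (θ k ω) U) atTop (𝓝 0)) ∧
      -- the equilibrium made stable by the coordination is such a set
      (CoordSA.IsHurwitz (C * A) → CoordSA.equilibrium A b ∈ interior (Set.Icc lo hi) →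
        CoordSA.IsAsympStable Φ (Set.Icc lo hi) {CoordSA.equilibrium A b}
          {x | x ∈ Set.Icc lo hi ∧
            Tendsto (fun t => Φ t x) atTop (𝓝 (CoordSA.equilibrium A b))}) ∧
      -- and the iterates converge to it if the coordinated ODE leaves the box invariant
      (CoordSA.IsHurwitz (C * A) →
        (∀ y : ℝ → Fin I → ℝ,
          IsIntegralCurveOn y (fun _ => CoordSA.coordField C A b) (Set.Ici 0) →
          y 0 ∈ Set.Icc lo hi → ∀ t, 0 ≤ t → y t ∈ Set.Icc lo hi) →
        ∀ᵐ ω ∂μ, Tendsto (fun k => θ k ω) atTop (𝓝 (CoordSA.equilibrium A b))) := by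
  refine ⟨fun i => hN.clm_comp ((ContinuousLinearMap.proj i).comp (CoordSA.matrixToCLM ℝ I C)),
    hN.clm_comp (CoordSA.matrixToCLM ℝ I C), ?_⟩
  rintro lo hi hlh ε hε hsum hε2 ⟨K, hK⟩ θ₀ θ rfl
  obtain ⟨L, hL⟩ := CoordSA.lipschitzWith_coordField C A b
  obtain ⟨M, hM⟩ := CoordSA.exists_norm_le_of_continuous (lo := lo) (hi := hi) hL.continuous
  obtain ⟨Φ, hΦ⟩ := CoordSA.exists_isProjFlow hlh hL
  have hflow := hΦ.isLipschitzSemiflow hlh hL hM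
  have hε0 : Tendsto ε atTop (𝓝 0) := by
    have := hε2.tendsto_atTop_zero.sqrt
    simpa only [Real.sqrt_sq (hε _).le, Real.sqrt_zero] using this
  have hrec := CoordSA.coordSA_succ (C := C) (b := b) (lo := lo) (hi := hi) hA ε N θ₀
  have hmem : ∀ k ω, CoordSA.coordSA C A b lo hi ε N θ₀ (k + 1) ω ∈ Set.Icc lo hi := fun k ω => by
    rw [hrec]
    exact CoordSA.boxProj_mem (fun i => (hlh i).le) _
  have htrack : ∀ᵐ ω ∂μ, CoordSA.Tracks Φ ε fun k => CoordSA.coordSA C A b lo hi ε N θ₀ k ω := by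
    filter_upwards [CoordSA.ae_exists_tendsto_sum_mulVec C hN hε2 hK] with ω hω
    exact hΦ.tracks hlh hL hε hε0 (fun k => hrec k ω) hω
  refine ⟨hmem, Φ, hΦ, fun T y hT hy hbox => hΦ.eq_of_isIntegralCurveOn hL hT hy hbox, htrack,
    ?_, ?_, fun hH hint => CoordSA.isAsympStable_equilibrium_of_mem_interior hΦ hlh hH hint,
    fun hH hinv => ?_⟩
  · filter_upwards [htrack] with ω hω
    exact ⟨CoordSA.limitSet_nonempty isCompact_Icc (hmem · ω),
      CoordSA.isCompact_limitSet isCompact_Icc (hmem · ω),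
      fun t ht => hω.image_limitSet hflow hε hε0 hsum isCompact_Icc (hmem · ω) ht,
      CoordSA.tendsto_infDist_limitSet isCompact_Icc (hmem · ω)⟩
  · filter_upwards [htrack] with ω hω U B hU K' hK' hK'B hvisit
    exact hU.tendsto_infDist hω hflow hε hε0 hsum isCompact_Icc (hmem · ω) hK' hK'B hvisit
  · filter_upwards [htrack] with ω hω
    have hvisit : ∃ᶠ k in atTop, CoordSA.coordSA C A b lo hi ε N θ₀ k ω ∈ Set.Icc lo hi :=
      Eventually.frequently (by
        filter_upwards [eventually_ge_atTop 1] with n hn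
        exact CoordSA.mem_of_recursion_mem
          (θ := fun k => CoordSA.coordSA C A b lo hi ε N θ₀ k ω) (hmem · ω) hn)
    have := (CoordSA.isAsympStable_equilibrium_of_invariant hΦ hlh hH hinv).tendsto_infDist hω
      hflow hε hε0 hsum isCompact_Icc (hmem · ω) isCompact_Icc subset_rfl hvisit
    simp_rw [Metric.infDist_singleton] at this
    exact tendsto_iff_dist_tendsto_zero.2 this
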